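/- For integers $1\le d<n$ let $\mathrm{Gr}_d(\mathbb{R}^n)$ be the Grassmannian of $d$-dimensional linear subspaces of $\mathbb{R}^n$, with its usual (quotient) topology, and let $\mathbb{RP}^k=\mathrm{Gr}_1(\mathbb{R}^{k+1})$; write $[u]\in\mathbb{RP}^k$ for the line spanned by $u\in\mathbb{R}^{k+1}\setminus\{0\}$, and $\langle x,y\rangle$ for the plane spanned by linearly independent $x,y$. A $\pi_1$-isomorphism is a continuous map that induces an isomorphism of fundamental groups (at every base point). Identify $\mathbb{R}^4$ with the quaternions $\mathbb{H}$ and $\mathbb{R}^8$ with the octonions $\mathbb{O}$, where $\mathbb{O}$ has the basis $e_0,\dots,e_7$ with unit $e_0$ and, for distinct $i,j\ge 1$, $e_i^2=-e_0$, $e_ie_j=-e_je_i$, and $e_1e_2=e_3$, $e_1e_4=e_5$, $e_2e_4=e_6$, $e_3e_4=e_7$, $e_2e_5=e_7$, $e_1e_7=e_6$, $e_3e_6=e_5$, together with the cyclic permutations of these relations. For $x,y$ both in $\mathbb{A}=\mathbb{H}$ or both in $\mathbb{A}=\mathbb{O}$ put $\mu_{\mathbb{A}}(x,y)=\tfrac12(y\bar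 x-x\bar y)$; this is a pure quaternion, respectively a pure octonion, and is regarded as an element of $\mathbb{R}^3$, respectively $\mathbb{R}^7$. For $d\in\{0,1,3,7\}$ identify $\mathbb{R}^{d+1}$ with the subalgebra of $\mathbb{O}$ spanned by $e_0,\dots,e_d$ (that is, $\mathbb{R},\mathbb{C},\mathbb{H},\mathbb{O}$); on it $\mu_{\mathbb{O}}$ takes values in the span $\mathbb{R}^d$ of $e_1,\dots,e_d$. **Theorem.** (1) The following formulas give well-defined continuous maps, all of which are $\pi_1$-isomorphisms: - $\nu_4:\mathrm{Gr}_2(\mathbb{R}^4)\to\mathbb{RP}^2$, $\langle x,y\rangle\mapsto[\mu_{\mathbb{H}}(x,y)]$; - $\nu_8:\mathrm{Gr}_2(\mathbb{R}^8)\to\mathbb{RP}^6$, $\langle x,y\rangle\mapsto[\mu_{\mathbb{O}}(x,y)]$; - for $d=0,1,3,7$ respectively, the maps $\mathrm{Gr}_2(\mathbb{R}^{9})\to\mathbb{RP}^{14}$, $\mathrm{Gr}_2(\mathbb{R}^{10})\to\mathbb{RP}^{15}$, $\mathrm{Gr}_2(\mathbb{R}^{12})\to\mathbb{RP}^{17}$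 and $\nu_{16}:\mathrm{Gr}_2(\mathbb{R}^{16})\to\mathbb{RP}^{21}$ given, for $x=(x_1,x_2)$ and $y=(y_1,y_2)$ in $\mathbb{R}^8\oplus\mathbb{R}^{d+1}$, by $$\langle x,y\rangle\mapsto[\mu_{\mathbb{O}}(x_1,y_1),\ \mu_{\mathbb{O}}(x_2,y_2),\ x_1y_2-y_1x_2]\in\mathbb{P}(\mathbb{R}^7\oplus\mathbb{R}^d\oplus\mathbb{R}^8).$$ (2) Let $(n,k)$ be one of $(4,2),(8,6),(9,14),(10,15),(12,17),(16,21)$ and let $f:\mathrm{Gr}_2(\mathbb{R}^n)\to\mathbb{RP}^k$ be any $\pi_1$-isomorphism. Then for every $m>2$ and every injective linear map $\mathbb{R}^m\to\mathbb{R}^n$, the composition of the induced inclusion $\mathrm{Gr}_2(\mathbb{R}^m)\to\mathrm{Gr}_2(\mathbb{R}^n)$ with $f$ is a $\pi_1$-isomorphism. -/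

import Mathlib

/-! ## Grassmannians and real projective spaces

The space `ℝⁿ` is `Fin n → ℝ`; only its vector space structure and its topology are used. -/

/-- Linearly independent `d`-tuples of vectors of `ℝⁿ`, as a subspace of `(ℝⁿ)^d`. -/
abbrev Frame (d n : ℕ) : Type :=
  {v : Fin d → (Fin n → ℝ) // LinearIndependent ℝ v}

/-- The real Grassmannian of `d`-dimensional linear subspaces of `ℝⁿ`. -/
def Gr (d n : ℕ) : Type :=
  {W : Submodule ℝ (Fin n → ℝ) // Module.finrank ℝ W = d}

namespace Gr

/-- The subspace spanned by a frame. -/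
def ofFrame {d n : ℕ} (v : Frame d n) : Gr d n :=
  ⟨Submodule.span ℝ (Set.range v.1), by simpa using finrank_span_eq_card v.2⟩

/-- The topology of the Grassmannian: the quotient topology from the space of frames. -/
instance instTopologicalSpace (d n : ℕ) : TopologicalSpace (Gr d n) :=
  TopologicalSpace.coinduced ofFrame inferInstance

/-- The map of frames given by an injective linear map. -/
def mapFrame {d m n : ℕ} (L : (Fin m → ℝ) →ₗ[ℝ] (Fin n → ℝ)) (hL : Function.Injective L)
    (v : Frame d m) : Frame d n :=
  ⟨fun i => L (v.1 i), v.2.map' L (LinearMap.ker_eq_bot.2 hL)⟩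

/-- The image of a subspace under an injective linear map. -/
def mapFun {d m n : ℕ} (L : (Fin m → ℝ) →ₗ[ℝ] (Fin n → ℝ)) (hL : Function.Injective L)
    (W : Gr d m) : Gr d n :=
  ⟨W.1.map L, ((Submodule.equivMapOfInjective L hL W.1).finrank_eq.symm).trans W.2⟩

theorem mapFun_ofFrame {d m n : ℕ} (L : (Fin m → ℝ) →ₗ[ℝ] (Fin n → ℝ))
    (hL : Function.Injective L) (v : Frame d m) :
    mapFun L hL (ofFrame v) = ofFrame (mapFrame L hL v) := by
  apply Subtype.ext
  change (Submodule.span ℝ (Set.range v.1)).map L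
    = Submodule.span ℝ (Set.range fun i => L (v.1 i))
  rw [Submodule.map_span, ← Set.range_comp]
  rfl

theorem continuous_mapFun {d m n : ℕ} (L : (Fin m → ℝ) →ₗ[ℝ] (Fin n → ℝ))
    (hL : Function.Injective L) : Continuous (mapFun (d := d) L hL) := by
  refine continuous_coinduced_dom.2 ?_
  have h : mapFun (d := d) L hL ∘ ofFrame = ofFrame ∘ mapFrame L hL :=
    funext (mapFun_ofFrame L hL)
  rw [h]
  refine Continuous.comp continuous_coinduced_rng ?_
  refine Continuous.subtype_mk (continuous_pi fun i => ?_) _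
  exact (LinearMap.continuous_of_finiteDimensional L).comp
    ((continuous_apply i).comp continuous_subtype_val)

/-- The inclusion `Gr_d(ℝᵐ) → Gr_d(ℝⁿ)` induced by a linear inclusion `ℝᵐ → ℝⁿ`. -/
def incl {d m n : ℕ} (L : (Fin m → ℝ) →ₗ[ℝ] (Fin n → ℝ)) (hL : Function.Injective L) :
    C(Gr d m, Gr d n) :=
  ⟨mapFun L hL, continuous_mapFun L hL⟩

end Gr

/-- The quotient topology on the projectivization of a real topological vector space. -/
instance instTopologicalSpaceProjectivization (V : Type*) [AddCommGroup V] [Module ℝ V]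
    [TopologicalSpace V] : TopologicalSpace (Projectivization ℝ V) :=
  inferInstanceAs (TopologicalSpace (Quotient (projectivizationSetoid ℝ V)))

/-- Real projective space of dimension `k`: the lines through the origin of `ℝᵏ⁺¹`. -/
abbrev RP (k : ℕ) : Type := Projectivization ℝ (Fin (k + 1) → ℝ)

/-- A continuous map is a `π₁`-isomorphism if it induces an isomorphism of fundamental groups at
every base point. -/
def IsPi1Iso {X Y : Type*} [TopologicalSpace X] [TopologicalSpace Y] (f : C(X, Y)) : Prop :=
  ∀ x : X, Function.Bijective (FundamentalGroup.map f x)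

/-- The map `f` is given by the formula `⟨x, y⟩ ↦ [μ(x, y)]` on the planes `⟨x, y⟩` of `ℝⁿ`;
in particular `μ(x, y)` is nonzero when `x`, `y` are linearly independent. -/
def IsGivenBy {n k : ℕ} (f : C(Gr 2 n, RP k))
    (μ : (Fin n → ℝ) → (Fin n → ℝ) → (Fin (k + 1) → ℝ)) : Prop :=
  ∀ v : Frame 2 n, ∃ h : μ (v.1 0) (v.1 1) ≠ 0,
    f (Gr.ofFrame v) = Projectivization.mk ℝ (μ (v.1 0) (v.1 1)) h

/-! ## Quaternions -/

/-- The usual identification of `ℝ⁴` with the quaternions. -/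
def toQuat (x : Fin 4 → ℝ) : Quaternion ℝ := ⟨x 0, x 1, x 2, x 3⟩

/-- The product `½ (y x̄ - x ȳ)` of quaternions, which is a pure quaternion, as an element of
`ℝ³`. -/
noncomputable def muH (x y : Fin 4 → ℝ) : Fin 3 → ℝ :=
  let z : Quaternion ℝ :=
    (1 / 2 : ℝ) • (toQuat y * star (toQuat x) - toQuat x * star (toQuat y))
  ![z.imI, z.imJ, z.imK]

/-! ## Octonions -/

/-- The product of the octonions, in coordinates with respect to the basis `e₀, …, e₇` of `ℝ⁸`.
Here `e₀` is the unit, `eᵢ² = -e₀` and `eᵢ eⱼ = - eⱼ eᵢ` for distinct `i, j ≥ 1`, and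
`e₁e₂ = e₃`, `e₁e₄ = e₅`, `e₂e₄ = e₆`, `e₃e₄ = e₇`, `e₂e₅ = e₇`, `e₁e₇ = e₆`, `e₃e₆ = e₅`,
each of these relations being invariant under cyclic permutations of its three indices. -/
def octMul (x y : Fin 8 → ℝ) : Fin 8 → ℝ :=
  ![x 0 * y 0 - x 1 * y 1 - x 2 * y 2 - x 3 * y 3
      - x 4 * y 4 - x 5 * y 5 - x 6 * y 6 - x 7 * y 7,
    x 0 * y 1 + x 1 * y 0 + x 2 * y 3 - x 3 * y 2
      + x 4 * y 5 - x 5 * y 4 - x 6 * y 7 + x 7 * y 6,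
    x 0 * y 2 - x 1 * y 3 + x 2 * y 0 + x 3 * y 1
      + x 4 * y 6 + x 5 * y 7 - x 6 * y 4 - x 7 * y 5,
    x 0 * y 3 + x 1 * y 2 - x 2 * y 1 + x 3 * y 0
      + x 4 * y 7 - x 5 * y 6 + x 6 * y 5 - x 7 * y 4,
    x 0 * y 4 - x 1 * y 5 - x 2 * y 6 - x 3 * y 7
      + x 4 * y 0 + x 5 * y 1 + x 6 * y 2 + x 7 * y 3,
    x 0 * y 5 + x 1 * y 4 - x 2 * y 7 + x 3 * y 6
      - x 4 * y 1 + x 5 * y 0 - x 6 * y 3 + x 7 * y 2,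
    x 0 * y 6 + x 1 * y 7 + x 2 * y 4 - x 3 * y 5
      - x 4 * y 2 + x 5 * y 3 + x 6 * y 0 - x 7 * y 1,
    x 0 * y 7 - x 1 * y 6 + x 2 * y 5 + x 3 * y 4
      - x 4 * y 3 - x 5 * y 2 + x 6 * y 1 + x 7 * y 0]

/-- Conjugation of octonions. -/
def octConj (x : Fin 8 → ℝ) : Fin 8 → ℝ :=
  fun i => if i = 0 then x i else -x i

/-- The product `½ (y x̄ - x ȳ)` of octonions, which is a pure octonion, as an element of `ℝ⁷`. -/
noncomputable def muO (x y : Fin 8 → ℝ) : Fin 7 → ℝ :=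
  fun i => ((1 / 2 : ℝ) • (octMul y (octConj x) - octMul x (octConj y))) i.succ

/-- The first component of a vector of `ℝ⁸ ⊕ ℝᵈ⁺¹`. -/
def fstOct {d : ℕ} (x : Fin (8 + (d + 1)) → ℝ) : Fin 8 → ℝ :=
  fun i => x (Fin.castAdd (d + 1) i)

/-- The second component of a vector of `ℝ⁸ ⊕ ℝᵈ⁺¹`, where `ℝᵈ⁺¹` is included in the octonions as
the span of `e₀, …, e_d` (for `d = 0, 1, 3, 7` these are the subalgebras `ℝ`, `ℂ`, `ℍ`, `𝕆`). -/
def sndOct {d : ℕ} (x : Fin (8 + (d + 1)) → ℝ) : Fin 8 → ℝ :=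
  fun i => if h : (i : ℕ) < d + 1 then x (Fin.natAdd 8 ⟨i, h⟩) else 0

/-- For `x = (x₁, x₂)` and `y = (y₁, y₂)` in `ℝ⁸ ⊕ ℝᵈ⁺¹`, the vector
`(μ(x₁, y₁), μ(x₂, y₂), x₁ y₂ - y₁ x₂)` of `ℝ⁷ ⊕ ℝᵈ ⊕ ℝ⁸`, where `μ` is the map `muO` and the
products are octonion products. If `d` is `0`, `1`, `3` or `7`, then `μ(x₂, y₂)` is in the span of
`e₁, …, e_d`. -/
noncomputable def muPair (d : ℕ) (hd : d ≤ 7) (x y : Fin (8 + (d + 1)) → ℝ) :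
    Fin (7 + d + 8) → ℝ :=
  Fin.append
    (Fin.append (muO (fstOct x) (fstOct y))
      (fun i : Fin d => muO (sndOct x) (sndOct y) (Fin.castLE hd i)))
    (octMul (fstOct x) (sndOct y) - octMul (fstOct y) (sndOct x))

/-! ### Homotopies of loops and lifting of paths -/

section Homotopy

open unitInterval Topology
open scoped ContDiff

variable {X : Type*} [TopologicalSpace X]

/-! An alternating bilinear `μ` is multiplied by `det M` when a basis of a plane is changed by `M`,
so if it vanishes on no independent pair it defines a map on planes. For `n ≥ 3` and `k ≥ 2` any
such map is a `π₁`-isomorphism (`IsGivenBy.isPi1Iso`). Indeed, a loop of planes lifts to a path of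
frames from `v` to `v.act M`, and a loop of lines lifts to a path on the sphere ending at plus or
minus its origin. Normalizing `μ` carries the first lift to the second, and the sign of `det M`
becomes the sign at the endpoint.

On each side this sign is a complete invariant. If `det M > 0`, the path of frames can be corrected
to a loop, and loops of frames give null-homotopic loops of planes
(`Gr.map_ofFrame_homotopic_refl`). In projective space, paths whose lifts share their endpoints are
homotopic (`RP.homotopic_of_lifts`). Surjectivity holds because a frame can be moved to the opposite
orientation of its plane.

For the inclusions, `μ (L x) (L y)` is again alternating and nonvanishing on independent pairs, so
the composite with the map given by `μ` is a `π₁`-isomorphism; hence so is the inclusion, and so is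
its composite with any `π₁`-isomorphism `f`.

It remains to see that the formulas do not vanish on independent pairs: `|μ(x, y)|² = |x|²|y|² -
(x·y)²` for quaternions and octonions, together with the multiplicativity of the octonion norm for
`muPair`. -/

/-- A loop that is freely homotopic to a null-homotopic loop is null-homotopic. -/
theorem Path.homotopic_refl_of_freeHomotopy {x y : X} {γ : Path x x} {γ' : Path y y}
    (H : C(I × I, X)) (h0 : ∀ t, H (0, t) = γ t) (h1 : ∀ t, H (1, t) = γ' t)
    (hs : ∀ s, H (s, 0) = H (s, 1)) (hγ' : γ'.Homotopic (Path.refl y)) :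
    γ.Homotopic (Path.refl x) := by
  have : ContractibleSpace I := (convex_Icc (0 : ℝ) 1).contractibleSpace ⟨0, by simp⟩
  let bot : Path ((0, 0) : I × I) (0, 1) :=
    ⟨⟨fun t => (0, t), by fun_prop⟩, rfl, rfl⟩
  let lft : Path ((0, 0) : I × I) (1, 0) :=
    ⟨⟨fun t => (t, 0), by fun_prop⟩, rfl, rfl⟩
  let top : Path ((1, 0) : I × I) (1, 1) :=
    ⟨⟨fun t => (1, t), by fun_prop⟩, rfl, rfl⟩
  let rgt : Path ((0, 1) : I × I) (1, 1) :=
    ⟨⟨fun t => (t, 1), by fun_prop⟩, rfl, rfl⟩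
  let β : Path x y := ⟨⟨fun s => H (s, 0), by fun_prop⟩, by simp [h0], by simp [h1]⟩
  -- In the simply connected square one side is homotopic to the path along the other three. By
  -- `hs`, `H` carries these to `γ` and to `γ'` conjugated by `β`.
  have key := ((SimplyConnectedSpace.paths_homotopic bot
    (lft.trans (top.trans rgt.symm))).map H).pathCast (x₂ := x) (x₃ := x)
      (by simp [h0]) (by simp [h0])
  have e1 : (bot.map H.continuous).cast (by simp [h0]) (by simp [h0]) = γ := by
    ext t; exact h0 t
  have e2 : ((lft.trans (top.trans rgt.symm)).map H.continuous).cast (by simp [h0]) (by simp [h0])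
      = β.trans (γ'.trans β.symm) := by
    ext t
    simp only [Path.cast_coe, Path.map_coe, Function.comp, Path.trans_apply]
    split_ifs
    · rfl
    · exact h1 _
    · exact (hs _).symm
  have key' : γ.Homotopic (β.trans (γ'.trans β.symm)) := by
    rw [← e1, ← e2]; exact key
  rw [← Path.Homotopic.Quotient.eq] at key' hγ' ⊢
  rw [key', Path.Homotopic.Quotient.mk_trans, Path.Homotopic.Quotient.mk_trans, hγ',
    Path.Homotopic.Quotient.mk_symm]
  simp

/-- A loop in an open subset `U` of a finite-dimensional space is null-homotopic in `U` as soon as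
all continuously differentiable loops in `U` are. -/
theorem Path.homotopic_refl_of_contDiff {E : Type*} [NormedAddCommGroup E] [NormedSpace ℝ E]
    [FiniteDimensional ℝ E] {U : Set E} (hU : IsOpen U)
    (h : ∀ p : ℝ → E, ContDiff ℝ 1 p → (∀ t : I, p t ∈ U) → ∀ (y : U) (γ : Path y y),
      (∀ t : I, (γ t : E) = p t) → γ.Homotopic (Path.refl y))
    {x : U} (γ : Path x x) : γ.Homotopic (Path.refl x) := by
  have hK : IsCompact (Set.range fun t : I => (γ t : E)) :=
    isCompact_range (by fun_prop)
  obtain ⟨δ, hδ, hδU⟩ := hK.exists_thickening_subset_open hU (by rintro _ ⟨t, rfl⟩; exact (γ t).2)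
  obtain ⟨g, hg, hgd, -⟩ := Continuous.exists_contDiff_approx (E := ℝ) (F := E)
    (f := fun t => (γ.extend t : E)) (ε := fun _ => δ / 3) 1
    (continuous_subtype_val.comp γ.continuous_extend) continuous_const (fun _ => by positivity)
  -- The affine correction closes the approximation up at `x`. It is a convex combination of two
  -- errors below `δ / 3`, so `p` stays within `δ` of `γ`, as do the segments joining them.
  let p : ℝ → E := fun t => g t + ((1 - t) • ((x : E) - g 0) + t • ((x : E) - g 1))
  have hp : ContDiff ℝ 1 p := by
    have : ContDiff ℝ 1 g := hg
    fun_prop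
  have hp0 : p 0 = x := by simp [p]
  have hp1 : p 1 = x := by simp [p]
  have hdist : ∀ t : I, dist (p t) (γ t : E) < δ := by
    intro t
    have a0 := hgd 0
    have a1 := hgd 1
    have at' := hgd t
    simp only [Path.extend_zero, Path.extend_one, Path.extend_apply _ t.2] at a0 a1 at'
    rw [dist_comm, dist_eq_norm] at a0 a1
    rw [dist_eq_norm] at at' ⊢
    have : p t - (γ t : E) = (g t - (γ t : E)) + ((1 - (t : ℝ)) • ((x : E) - g 0)
      + (t : ℝ) • ((x : E) - g 1)) := by simp only [p]; abel
    rw [this]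
    have ht0 := t.2.1
    have ht1 := t.2.2
    calc _ ≤ ‖g t - (γ t : E)‖ + (‖(1 - (t : ℝ)) • ((x : E) - g 0)‖
        + ‖(t : ℝ) • ((x : E) - g 1)‖) :=
          (norm_add_le _ _).trans (add_le_add_right (norm_add_le _ _) _)
      _ = ‖g t - (γ t : E)‖ + ((1 - (t : ℝ)) * ‖(x : E) - g 0‖ + t * ‖(x : E) - g 1‖) := by
          rw [norm_smul, norm_smul, Real.norm_of_nonneg ht0, Real.norm_of_nonneg (by linarith)]
      _ < δ := by
          have := mul_le_mul_of_nonneg_left a0.le (show 0 ≤ 1 - (t : ℝ) by linarith)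
          have := mul_le_mul_of_nonneg_left a1.le ht0
          have : g t - (γ t : E) = g t - (γ ⟨t, t.2⟩ : E) := rfl
          nlinarith
  have hline : ∀ s t : I, (1 - (s : ℝ)) • (γ t : E) + (s : ℝ) • p t ∈ U := by
    intro s t
    apply hδU
    refine Metric.mem_thickening_iff.2 ⟨γ t, ⟨t, rfl⟩, ?_⟩
    have : (1 - (s : ℝ)) • (γ t : E) + (s : ℝ) • p t - γ t = (s : ℝ) • (p t - (γ t : E)) := by
      module
    rw [dist_eq_norm, this, norm_smul, Real.norm_of_nonneg s.2.1, ← dist_eq_norm]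
    calc _ ≤ 1 * dist (p t) (γ t : E) := mul_le_mul_of_nonneg_right s.2.2 dist_nonneg
      _ < δ := by rw [one_mul]; exact hdist t
  have hpU : ∀ t : I, p t ∈ U := fun t => by simpa using hline 1 t
  have hpc := hp.continuous
  let γ' : Path x x := ⟨⟨fun t => ⟨p t, hpU t⟩, by fun_prop⟩, by ext; simp [hp0], by ext; simp [hp1]⟩
  refine Path.homotopic_refl_of_freeHomotopy (γ' := γ')
    ⟨fun st => ⟨(1 - (st.1 : ℝ)) • (γ st.2 : E) + (st.1 : ℝ) • p st.2, hline _ _⟩, by fun_prop⟩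
    (fun t => ?_) (fun t => ?_) (fun s => ?_) (h p hp hpU x γ' fun _ => rfl)
  · ext; simp
  · ext; simp [γ']
  · ext; simp [hp0, hp1]

/-- The complement of the origin in `ℝⁿ`, `n ≥ 3`, is simply connected. -/
theorem simplyConnectedSpace_ne_zero {n : ℕ} (hn : 3 ≤ n) :
    SimplyConnectedSpace {v : Fin n → ℝ // v ≠ 0} := by
  have hpc : IsPathConnected ({0}ᶜ : Set (Fin n → ℝ)) :=
    isPathConnected_compl_singleton_of_one_lt_rank (by
      rw [rank_fin_fun]; exact_mod_cast (by omega : 1 < n)) 0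
  refine simply_connected_iff_loops_nullhomotopic.2
    ⟨isPathConnected_iff_pathConnectedSpace.1 hpc, fun x γ => ?_⟩
  refine Path.homotopic_refl_of_contDiff (U := {v : Fin n → ℝ | v ≠ 0}) isOpen_ne ?_ γ
  intro p hp hpU y γ hγ
  -- The cone over a `C¹` loop is the `C¹` image of a 2-dimensional space, so it misses some `w`. A
  -- segment from `p t` to `-w` through the origin would put `w` on the cone; hence the loop
  -- contracts linearly to `-w`.
  have hdense := ContDiff.dense_compl_range_of_finrank_lt_finrank
    (f := fun q : ℝ × ℝ => q.1 • p q.2) (by fun_prop) (by simp; omega)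
  obtain ⟨w, hw⟩ := hdense.nonempty
  have hline : ∀ s t : I, (1 - (s : ℝ)) • p t + (s : ℝ) • (-w) ≠ 0 := by
    intro s t h0
    by_cases hs : (s : ℝ) = 0
    · simp [hs] at h0; exact hpU t h0
    · refine hw ⟨((s : ℝ)⁻¹ * (1 - s), t), ?_⟩
      rw [smul_neg, add_neg_eq_zero] at h0
      simp only [mul_smul, h0, inv_smul_smul₀ hs]
  have hpc := hp.continuous
  have hw0 : -w ≠ 0 := by simpa using hline 1 0
  have hends : p 0 = p 1 := by
    have h0 := hγ 0
    have h1 := hγ 1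
    simp only [Path.source, Path.target] at h0 h1
    simpa using h0.symm.trans h1
  refine Path.homotopic_refl_of_freeHomotopy
    (γ' := Path.refl (⟨-w, hw0⟩ : {v : Fin n → ℝ // v ≠ 0}))
    ⟨fun st => ⟨(1 - (st.1 : ℝ)) • p st.2 + (st.1 : ℝ) • (-w), hline _ _⟩, by fun_prop⟩
    (fun t => ?_) (fun t => ?_) (fun s => ?_) (Path.Homotopic.refl _)
  · apply Subtype.ext; simp [hγ]
  · apply Subtype.ext; simp
  · apply Subtype.ext; simp [hends]

/-- Path lifting for a continuous map with local sections, each fibre of which is permuted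
transitively by continuous self-maps over the base. -/
theorem exists_path_lift_of_local_sections {E : Type*} [TopologicalSpace E] {p : E → X}
    (hsec : ∀ x, ∃ U : Set X, IsOpen U ∧ x ∈ U ∧
      ∃ s : X → E, ContinuousOn s U ∧ ∀ y ∈ U, p (s y) = y)
    (htrans : ∀ e e', p e = p e' → ∃ φ : E → E, Continuous φ ∧ (∀ z, p (φ z) = p z) ∧ φ e = e')
    (γ : C(I, X)) (e : E) (γ_0 : γ 0 = p e) : ∃ Γ : C(I, E), p ∘ Γ = γ ∧ Γ 0 = e := by
  choose U U_open mem_U sec hsec hpsec using hsec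
  obtain ⟨t, t_0, t_mono, ⟨n_max, h_max⟩, t_sub⟩ :=
    exists_monotone_Icc_subset_open_cover_unitInterval
    (fun x ↦ (U_open x).preimage γ.continuous) fun t _ ↦ Set.mem_iUnion.2 ⟨γ t, mem_U _⟩
  suffices ∀ n, ∃ Γ : I → E, ContinuousOn Γ (Set.Icc 0 (t n)) ∧
      (Set.Icc 0 (t n)).EqOn (p ∘ Γ) γ ∧ Γ 0 = e by
    obtain ⟨Γ, cont, eqOn, Γ_0⟩ := this n_max
    rw [h_max _ le_rfl] at cont eqOn
    exact ⟨⟨Γ, continuousOn_univ.mp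
      (by convert! cont; rw [eq_comm, Set.eq_univ_iff_forall]; exact fun t ↦ ⟨bot_le, le_top⟩)⟩,
      funext fun _ ↦ eqOn ⟨bot_le, le_top⟩, Γ_0⟩
  intro n
  induction n with
  | zero =>
    refine ⟨fun _ ↦ e, continuous_const.continuousOn, fun t ht ↦ ?_, rfl⟩
    rw [t_0, Set.Icc_self, Set.mem_singleton_iff] at ht; subst ht; exact γ_0.symm
  | succ n ih => ?_
  obtain ⟨Γ, cont, eqOn, Γ_0⟩ := ih
  obtain ⟨x, t_sub⟩ := t_sub n
  have pΓtn : p (Γ (t n)) = γ (t n) := eqOn ⟨t_0 ▸ t_mono n.zero_le, le_rfl⟩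
  have hmem : γ (t n) ∈ U x := t_sub ⟨le_rfl, t_mono n.le_succ⟩
  -- The fibres need not be discrete: `φ` moves the local section so that it starts where the lift
  -- built so far ends.
  obtain ⟨φ, hφ, hpφ, hφe⟩ := htrans (sec x (γ (t n))) (Γ (t n)) ((hpsec x _ hmem).trans pΓtn.symm)
  refine ⟨fun s ↦ if s ≤ t n then Γ s else φ (sec x (γ s)),
    .if (fun s hs ↦ ?_) (cont.mono fun _ h ↦ ?_) ?_, fun s hs ↦ ?_, ?_⟩
  · cases frontier_Iic_subset _ hs.2
    exact hφe.symm
  · rw [closure_le_eq continuous_id' continuous_const] at h; exact ⟨h.1.1, h.2⟩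
  · refine hφ.comp_continuousOn ((hsec x).comp γ.continuous.continuousOn ?_)
    simp_rw [not_le]; intro s h
    exact t_sub ⟨closure_lt_subset_le continuous_const continuous_subtype_val h.2, h.1.2⟩
  · rw [Function.comp_apply]; split_ifs with h
    exacts [eqOn ⟨hs.1, h⟩, (hpφ _).trans (hpsec x _ (t_sub ⟨le_of_not_ge h, hs.2⟩))]
  · dsimp only; rwa [if_pos (t_0 ▸ t_mono n.zero_le)]

end Homotopy

/-! ### Frames and the bundle of frames over the Grassmannian of planes -/

section Frames

open unitInterval Topology Matrix

variable {n : ℕ}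

namespace Frame

theorem pair_linearIndependent (v : Frame 2 n) : LinearIndependent ℝ ![v.1 0, v.1 1] := by
  have : ![v.1 0, v.1 1] = v.1 := by ext i; fin_cases i <;> rfl
  rw [this]; exact v.2

/-- The change of basis of a frame of a plane by an invertible matrix. -/
def act (M : Matrix (Fin 2) (Fin 2) ℝ) (hM : M.det ≠ 0) (v : Frame 2 n) : Frame 2 n :=
  ⟨![M 0 0 • v.1 0 + M 0 1 • v.1 1, M 1 0 • v.1 0 + M 1 1 • v.1 1],
    by
      rw [det_fin_two] at hM
      refine LinearIndependent.pair_iff.2 fun s t h => ?_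
      obtain ⟨h0, h1⟩ := LinearIndependent.pair_iff.1 v.pair_linearIndependent
        (s * M 0 0 + t * M 1 0) (s * M 0 1 + t * M 1 1) (by rw [← h]; module)
      constructor
      · refine (mul_eq_zero.1 (?_ : s * _ = 0)).resolve_right hM
        linear_combination M 1 1 * h0 - M 1 0 * h1
      · refine (mul_eq_zero.1 (?_ : t * _ = 0)).resolve_right hM
        linear_combination M 0 0 * h1 - M 0 1 * h0⟩

variable {M : Matrix (Fin 2) (Fin 2) ℝ}

@[simp]
theorem act_zero (hM : M.det ≠ 0) (v : Frame 2 n) :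
    (act M hM v).1 0 = M 0 0 • v.1 0 + M 0 1 • v.1 1 := rfl

@[simp]
theorem act_one (hM : M.det ≠ 0) (v : Frame 2 n) :
    (act M hM v).1 1 = M 1 0 • v.1 0 + M 1 1 • v.1 1 := rfl

theorem ext_pair {v w : Frame 2 n} (h0 : v.1 0 = w.1 0) (h1 : v.1 1 = w.1 1) : v = w := by
  apply Subtype.ext; funext i; fin_cases i <;> assumption

theorem continuous_mk_pair {T : Type*} [TopologicalSpace T] {f : T → Frame 2 n}
    (h0 : Continuous fun t => (f t).1 0) (h1 : Continuous fun t => (f t).1 1) :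
    Continuous f := by
  refine continuous_induced_rng.2 (continuous_pi fun i => ?_)
  fin_cases i
  exacts [h0, h1]

theorem continuous_apply (i : Fin 2) : Continuous fun v : Frame 2 n => v.1 i :=
  (_root_.continuous_apply i).comp continuous_subtype_val

theorem continuous_act (hM : M.det ≠ 0) : Continuous (act M hM : Frame 2 n → Frame 2 n) := by
  have h := continuous_apply (n := n)
  exact continuous_mk_pair (((h 0).const_smul (M 0 0)).add ((h 1).const_smul (M 0 1)))
    (((h 0).const_smul (M 1 0)).add ((h 1).const_smul (M 1 1)))

end Frame

namespace Gr

theorem ofFrame_surjective {d : ℕ} : Function.Surjective (ofFrame : Frame d n → Gr d n) := by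
  intro W
  have b := Module.finBasisOfFinrankEq ℝ W.1 W.2
  refine ⟨⟨fun i => (b i : Fin n → ℝ), b.linearIndependent.map' W.1.subtype W.1.ker_subtype⟩,
    Subtype.ext ?_⟩
  change Submodule.span ℝ (Set.range (W.1.subtype ∘ b)) = W.1
  rw [Set.range_comp, ← Submodule.map_span, b.span_eq, Submodule.map_top, W.1.range_subtype]

theorem isQuotientMap_ofFrame {d : ℕ} : IsQuotientMap (ofFrame : Frame d n → Gr d n) :=
  ⟨⟨rfl⟩, ofFrame_surjective⟩

theorem ofFrame_eq_of_mem {d : ℕ} {v : Frame d n} {W : Gr d n} (h : ∀ i, v.1 i ∈ W.1) :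
    ofFrame v = W := by
  apply Subtype.ext
  refine Submodule.eq_of_le_of_finrank_eq (Submodule.span_le.2 ?_) ((ofFrame v).2.trans W.2.symm)
  rintro _ ⟨i, rfl⟩; exact h i

theorem mem_ofFrame {v : Frame 2 n} {z : Fin n → ℝ} :
    z ∈ (ofFrame v).1 ↔ ∃ a b : ℝ, a • v.1 0 + b • v.1 1 = z := by
  have : Set.range v.1 = {v.1 0, v.1 1} := by
    ext z; simp [Fin.exists_fin_two, eq_comm]
  change z ∈ Submodule.span ℝ (Set.range v.1) ↔ _
  rw [this, Submodule.mem_span_pair]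

@[simp]
theorem ofFrame_act {M : Matrix (Fin 2) (Fin 2) ℝ} (hM : M.det ≠ 0) (v : Frame 2 n) :
    ofFrame (v.act M hM) = ofFrame v := by
  refine ofFrame_eq_of_mem fun i => mem_ofFrame.2 ?_
  fin_cases i
  exacts [⟨_, _, rfl⟩, ⟨_, _, rfl⟩]

theorem exists_act_of_ofFrame_eq {v w : Frame 2 n} (h : ofFrame v = ofFrame w) :
    ∃ (M : Matrix (Fin 2) (Fin 2) ℝ) (hM : M.det ≠ 0), w = v.act M hM := by
  have hw : ∀ i, w.1 i ∈ (ofFrame v).1 := fun i => by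
    rw [h]; exact Submodule.subset_span ⟨i, rfl⟩
  obtain ⟨a, b, h0⟩ := mem_ofFrame.1 (hw 0)
  obtain ⟨c, d, h1⟩ := mem_ofFrame.1 (hw 1)
  refine ⟨!![a, b; c, d], ?_, Frame.ext_pair h0.symm h1.symm⟩
  intro hdet
  rw [det_fin_two_of] at hdet
  have hind := LinearIndependent.pair_iff.1 w.pair_linearIndependent
  -- If the determinant vanishes, the rows of the adjugate, up to order and sign, give linear
  -- relations on `w`; independence then kills `a` and `b`, so `w.1 0 = 0`.
  have e1 := hind d (-b) (by
    rw [← h0, ← h1]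
    calc _ = (a * d - b * c) • v.1 0 := by module
      _ = 0 := by rw [hdet, zero_smul])
  have e2 := hind (-c) a (by
    rw [← h0, ← h1]
    calc _ = (a * d - b * c) • v.1 1 := by module
      _ = 0 := by rw [hdet, zero_smul])
  have hb : b = 0 := by linarith [e1.2]
  have : w.1 0 = 0 := by rw [← h0, e2.2, hb]; simp
  exact w.2.ne_zero 0 this

/-- Near every plane there is a continuous choice of a basis. -/
theorem exists_local_section (W : Gr 2 n) : ∃ U : Set (Gr 2 n), IsOpen U ∧ W ∈ U ∧
    ∃ s : Gr 2 n → Frame 2 n, ContinuousOn s U ∧ ∀ y ∈ U, ofFrame (s y) = y := by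
  obtain ⟨v₀, rfl⟩ := ofFrame_surjective W
  -- `A` takes coordinates with respect to `v₀` along some complement. The planes on which it is
  -- invertible form `U`, and each has exactly one frame with coordinate matrix `N = 1`; this frame
  -- is the section.
  obtain ⟨A, hA⟩ := (Fintype.linearCombination ℝ v₀.1).exists_leftInverse_of_injective
    (LinearMap.ker_eq_bot.2 v₀.2.fintypeLinearCombination_injective)
  have hA' : ∀ i, A (v₀.1 i) = Pi.single i 1 := fun i => by
    have := LinearMap.congr_fun hA (Pi.single i 1)
    simpa using this
  have hAc : Continuous A := A.continuous_of_finiteDimensional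
  let N : Frame 2 n → Matrix (Fin 2) (Fin 2) ℝ := fun v => .of fun i j => A (v.1 i) j
  have hN : Continuous N := by
    have := Frame.continuous_apply (n := n)
    refine continuous_matrix fun i j => ?_
    exact (continuous_apply j).comp (hAc.comp (this i))
  have hNact : ∀ (v : Frame 2 n) M hM, N (v.act M hM) = M * N v := fun v M hM => by
    ext i j
    fin_cases i <;> simp [N, Matrix.mul_apply, Fin.sum_univ_two]
  have hNinv : ∀ v, (N v).det ≠ 0 → ((N v)⁻¹).det ≠ 0 := fun v hv => by
    rw [det_nonsing_inv, Ring.inverse_eq_inv']; exact inv_ne_zero hv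
  let U : Set (Gr 2 n) := {W | ∃ v, ofFrame v = W ∧ (N v).det ≠ 0}
  have hU : ∀ v, ofFrame v ∈ U ↔ (N v).det ≠ 0 := fun v => by
    refine ⟨fun ⟨w, hw, hdet⟩ => ?_, fun h => ⟨v, rfl, h⟩⟩
    obtain ⟨M, hM, rfl⟩ := exists_act_of_ofFrame_eq hw
    rw [hNact, det_mul]; exact mul_ne_zero hM hdet
  have hUo : IsOpen U := by
    rw [← isQuotientMap_ofFrame.isOpen_preimage]
    have : ofFrame ⁻¹' U = {v : Frame 2 n | (N v).det ≠ 0} := by ext v; exact hU v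
    rw [this]
    exact isOpen_ne.preimage hN.matrix_det
  let s : {v : Frame 2 n // (N v).det ≠ 0} → Frame 2 n := fun v => v.1.act (N v.1)⁻¹ (hNinv _ v.2)
  have hs_inv : ∀ v w, ofFrame v.1 = ofFrame w.1 → s v = s w := by
    intro v w h
    have h' : ofFrame (s v) = ofFrame (s w) := by simp only [s, ofFrame_act, h]
    have hNs : ∀ v, N (s v) = 1 := fun v => by
      simp only [s, hNact]; exact Matrix.nonsing_inv_mul _ (isUnit_iff_ne_zero.2 v.2)
    obtain ⟨M, hM, hw⟩ := exists_act_of_ofFrame_eq h'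
    have hM1 : M = 1 := by
      have := hNs w
      rwa [hw, hNact, hNs, mul_one] at this
    subst hM1
    rw [hw]
    exact Frame.ext_pair (by simp) (by simp)
  have hsc : Continuous s := by
    have hc : Continuous fun v : {v : Frame 2 n // (N v).det ≠ 0} => (N v.1)⁻¹ := by
      have : (fun v : {v : Frame 2 n // (N v).det ≠ 0} => (N v.1)⁻¹) =
          fun v => (N v.1).det⁻¹ • (N v.1).adjugate := by
        funext v; rw [Matrix.inv_def, Ring.inverse_eq_inv']
      rw [this]
      have hd : Continuous fun v : {v : Frame 2 n // (N v).det ≠ 0} => (N v.1) :=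
        hN.comp continuous_subtype_val
      exact (hd.matrix_det.inv₀ fun v => v.2).smul hd.matrix_adjugate
    have hv : ∀ i, Continuous fun v : {v : Frame 2 n // (N v).det ≠ 0} => v.1.1 i := fun i =>
      (Frame.continuous_apply i).comp continuous_subtype_val
    refine Frame.continuous_mk_pair ?_ ?_
    · exact ((hc.matrix_elem 0 0).smul (hv 0)).add ((hc.matrix_elem 0 1).smul (hv 1))
    · exact ((hc.matrix_elem 1 0).smul (hv 0)).add ((hc.matrix_elem 1 1).smul (hv 1))
  choose r hr using (ofFrame_surjective : Function.Surjective (ofFrame : Frame 2 n → Gr 2 n))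
  classical
  -- On `U` the value does not depend on the choice `r`, by `hs_inv`; outside `U` it is irrelevant.
  let σ' : Gr 2 n → Frame 2 n := fun W => if h : (N (r W)).det ≠ 0 then s ⟨r W, h⟩ else r W
  have hσ' : ∀ v (h : (N v).det ≠ 0), σ' (ofFrame v) = s ⟨v, h⟩ := fun v h => by
    have h1 : (N (r (ofFrame v))).det ≠ 0 := by rw [← hU, hr, hU]; exact h
    simp only [σ', dif_pos h1]
    exact hs_inv _ _ (hr _)
  have hv₀ : N v₀ = 1 := by
    ext i j; simp [N, hA', Matrix.one_apply, Pi.single_apply, eq_comm]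
  refine ⟨U, hUo, (hU _).2 (by simp [hv₀]), σ', ?_, ?_⟩
  · rw [continuousOn_iff_continuous_domRestrict,
      (isQuotientMap_ofFrame.restrictPreimage_isOpen hUo).continuous_iff]
    have : U.domRestrict σ' ∘ U.restrictPreimage ofFrame =
        s ∘ fun v : ofFrame ⁻¹' U => ⟨v.1, (hU _).1 v.2⟩ := by
      funext v; exact hσ' v.1 ((hU _).1 v.2)
    rw [this]
    exact hsc.comp (by fun_prop)
  · rintro _ ⟨v, rfl, h⟩
    rw [hσ' v h]
    exact ofFrame_act _ _

/-- Paths in the Grassmannian of planes lift to paths of frames. -/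
theorem exists_path_lift (γ : C(I, Gr 2 n)) (v : Frame 2 n) (h : γ 0 = ofFrame v) :
    ∃ Γ : C(I, Frame 2 n), ofFrame ∘ Γ = γ ∧ Γ 0 = v := by
  refine exists_path_lift_of_local_sections exists_local_section (fun e e' he => ?_) γ v h
  obtain ⟨M, hM, rfl⟩ := exists_act_of_ofFrame_eq he
  exact ⟨_, Frame.continuous_act hM, ofFrame_act hM, rfl⟩

end Gr

/-- The real `2 × 2` matrices of positive determinant form a path connected space. -/
theorem joinedIn_one_of_det_pos {M : Matrix (Fin 2) (Fin 2) ℝ} (hM : 0 < M.det) :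
    JoinedIn {N : Matrix (Fin 2) (Fin 2) ℝ | 0 < N.det} 1 M := by
  let φ : ℂ → Matrix (Fin 2) (Fin 2) ℝ := fun z => !![z.re, -z.im; z.im, z.re]
  have hφ : Continuous φ := by
    refine continuous_matrix fun i j => ?_
    fin_cases i <;> fin_cases j <;> simp [φ] <;> fun_prop
  rw [det_fin_two] at hM
  -- `φ z` is the conformal part of `M`. The remainder `B` is symmetric and trace-free, and `det (φ
  -- z + t B) = |z|² - t² |B|²`, where `|B|²` is half the sum of the squared entries. For `t` in
  -- `[0, 1]` this is at least `det M`.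
  let z : ℂ := ⟨(M 0 0 + M 1 1) / 2, (M 1 0 - M 0 1) / 2⟩
  have hz : z ≠ 0 := by
    intro h
    have h1 : (M 0 0 + M 1 1) / 2 = 0 := congrArg Complex.re h
    have h2 : (M 1 0 - M 0 1) / 2 = 0 := congrArg Complex.im h
    have h3 : M 1 1 = - M 0 0 := by linarith
    have h4 : M 1 0 = M 0 1 := by linarith
    rw [h3, h4] at hM
    nlinarith [sq_nonneg (M 0 0), sq_nonneg (M 0 1)]
  have hpc : IsPathConnected ({0}ᶜ : Set ℂ) :=
    isPathConnected_compl_singleton_of_one_lt_rank (by simp) 0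
  have j1 : JoinedIn {N : Matrix (Fin 2) (Fin 2) ℝ | 0 < N.det} (φ 1) (φ z) := by
    refine ((hpc.joinedIn 1 (by simp) z (by simpa using hz)).map hφ).mono ?_
    rintro _ ⟨w, hw, rfl⟩
    have hw' : 0 < Complex.normSq w := Complex.normSq_pos.2 hw
    rw [Complex.normSq_apply] at hw'
    simp only [Set.mem_ofPred_eq, φ, det_fin_two_of]
    linarith
  have j2 : JoinedIn {N : Matrix (Fin 2) (Fin 2) ℝ | 0 < N.det} (φ z) M := by
    refine JoinedIn.ofLine (f := fun t : ℝ => (1 - t) • φ z + t • M) (by fun_prop) (by simp)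
      (by simp) ?_
    rintro _ ⟨t, ⟨ht0, ht1⟩, rfl⟩
    simp only [Set.mem_ofPred_eq, det_fin_two, φ, z]
    simp
    have ht : t ^ 2 ≤ 1 := by nlinarith
    nlinarith [mul_nonneg (sub_nonneg.2 ht) (add_nonneg (sq_nonneg ((M 0 0 - M 1 1) / 2))
      (sq_nonneg ((M 0 1 + M 1 0) / 2)))]
  have h1 : φ 1 = 1 := by
    ext i j; fin_cases i <;> fin_cases j <;> simp [φ]
  rw [← h1]
  exact j1.trans j2

/-- A path of frames whose endpoints are bases of a plane defining the same orientation can be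
replaced by a loop of frames spanning the same planes. -/
theorem Frame.exists_loop {v : Frame 2 n} (Γ : C(I, Frame 2 n)) (h0 : Γ 0 = v)
    {M : Matrix (Fin 2) (Fin 2) ℝ} (hM : 0 < M.det) (h1 : Γ 1 = v.act M hM.ne') :
    ∃ Γ' : Path v v, ∀ t, Gr.ofFrame (Γ' t) = Gr.ofFrame (Γ t) := by
  have hMu : IsUnit M.det := isUnit_iff_ne_zero.2 hM.ne'
  have hMi : 0 < (M⁻¹).det := by
    rw [det_nonsing_inv, Ring.inverse_eq_inv']; exact inv_pos.2 hM
  -- Acting on `Γ` by a path of matrices from `1` to `M⁻¹` leaves its planes and its origin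
  -- unchanged and brings its end back to `v`.
  have hj := joinedIn_one_of_det_pos hMi
  have hB : ∀ t, (hj.somePath t).det ≠ 0 := fun t => (hj.somePath_mem t).ne'
  have hBc := hj.somePath.continuous
  have hΓ : ∀ i, Continuous fun t => (Γ t).1 i := fun i =>
    (Frame.continuous_apply i).comp Γ.continuous
  refine ⟨⟨⟨fun t => (Γ t).act (hj.somePath t) (hB t), ?_⟩, ?_, ?_⟩,
    fun t => Gr.ofFrame_act (hB t) _⟩
  · refine Frame.continuous_mk_pair ?_ ?_
    · exact ((hBc.matrix_elem 0 0).smul (hΓ 0)).add ((hBc.matrix_elem 0 1).smul (hΓ 1))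
    · exact ((hBc.matrix_elem 1 0).smul (hΓ 0)).add ((hBc.matrix_elem 1 1).smul (hΓ 1))
  · apply Frame.ext_pair <;> simp [h0]
  · have hid := Matrix.nonsing_inv_mul M hMu
    have e := fun i j => congrFun (congrFun hid i) j
    simp only [Matrix.mul_apply, Fin.sum_univ_two] at e
    have key : ∀ a b c d p q : ℝ, ∀ x y : Fin n → ℝ, p • (a • x + b • y) + q • (c • x + d • y)
        = (p * a + q * c) • x + (p * b + q * d) • y := fun a b c d p q x y => by module
    apply Frame.ext_pair
    · simp only [h1, act_zero, act_one, hj.somePath.target, key, e]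
      simp
    · simp only [h1, act_zero, act_one, hj.somePath.target, key, e]
      simp

end Frames

/-! ### Loops of planes that lift to loops of frames -/

section FrameLoops

open unitInterval Topology Matrix

/-- A relation with nonzero coefficient `α * s` at `w` would place `w` in the plane of `x` and `y`.
Thus one vector of a frame can slide linearly to any point off the plane. -/
theorem linearIndependent_pair_lineMap {E : Type*} [AddCommGroup E] [Module ℝ E] {x y w : E}
    (h : LinearIndependent ℝ ![x, y]) (hw : ∀ a b : ℝ, a • x + b • y ≠ w) (s : ℝ) :
    LinearIndependent ℝ ![(1 - s) • x + s • w, y] := by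
  refine LinearIndependent.pair_iff.2 fun α β h0 => ?_
  have hαs : α * s = 0 := by
    by_contra hne
    refine hw (-((α * s)⁻¹ * (α * (1 - s)))) (-((α * s)⁻¹ * β)) ?_
    have h1 : (α * s) • w = -((α * (1 - s)) • x + β • y) := by
      rw [eq_neg_iff_add_eq_zero, ← h0]; module
    rw [← inv_smul_smul₀ hne w, h1]
    module
  obtain ⟨h1, h2⟩ := LinearIndependent.pair_iff.1 h (α * (1 - s)) β (by
    calc _ = α • ((1 - s) • x + s • w) + β • y - (α * s) • w := by module
      _ = 0 := by rw [h0, hαs]; simp)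
  exact ⟨by linarith, h2⟩

/-- Loops of frames of planes in `ℝⁿ`, `n ≥ 4`, are null-homotopic. -/
theorem Frame.homotopic_refl {n : ℕ} (hn : 4 ≤ n) {v : Frame 2 n} (γ : Path v v) :
    γ.Homotopic (Path.refl v) := by
  refine Path.homotopic_refl_of_contDiff
    (U := {v : Fin 2 → Fin n → ℝ | LinearIndependent ℝ v}) isOpen_setOfPred_linearIndependent ?_ γ
  intro p hp hpU y γ hγ
  have hp' : ∀ i, ContDiff ℝ 1 fun t => p t i := fun i => contDiff_pi.1 hp i
  have hpc : ∀ i, Continuous fun t => p t i := fun i => (hp' i).continuous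
  have h0 := hp' 0
  have h1 := hp' 1
  have hc0 := hpc 0
  have hc1 := hpc 1
  have hpair : ∀ v : Fin 2 → Fin n → ℝ, ![v 0, v 1] = v := fun v => by
    ext i; fin_cases i <;> rfl
  have hind : ∀ t : I, LinearIndependent ℝ ![p t 0, p t 1] := fun t => by
    rw [hpair]; exact hpU t
  have hfr : Module.finrank ℝ (ℝ × ℝ × ℝ) < Module.finrank ℝ (Fin n → ℝ) := by
    simp; omega
  -- The planes of a `C¹` loop sweep out the `C¹` image of a 3-dimensional space, so for `n ≥ 4`
  -- some `w` avoids them all. The first vector slides to `w`, then the second to a `w'` off all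
  -- planes `⟨p t 1, w⟩`, which leaves a constant frame.
  obtain ⟨w, hw⟩ := (ContDiff.dense_compl_range_of_finrank_lt_finrank
    (f := fun q : ℝ × ℝ × ℝ => q.2.1 • p q.1 0 + q.2.2 • p q.1 1) (by fun_prop) hfr).nonempty
  obtain ⟨w', hw'⟩ := (ContDiff.dense_compl_range_of_finrank_lt_finrank
    (f := fun q : ℝ × ℝ × ℝ => q.2.1 • p q.1 1 + q.2.2 • w) (by fun_prop) hfr).nonempty
  have hl1 : ∀ s t : I, LinearIndependent ℝ ![(1 - (s : ℝ)) • p t 0 + (s : ℝ) • w, p t 1] :=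
    fun s t => linearIndependent_pair_lineMap (hind t) (fun a b h => hw ⟨(t, a, b), h⟩) s
  have hind' : ∀ t : I, LinearIndependent ℝ ![p t 1, w] := fun t => by
    rw [LinearIndependent.pair_symm_iff]; simpa using hl1 1 t
  have hl2 : ∀ s t : I, LinearIndependent ℝ ![w, (1 - (s : ℝ)) • p t 1 + (s : ℝ) • w'] :=
    fun s t => by
      rw [LinearIndependent.pair_symm_iff]
      exact linearIndependent_pair_lineMap (hind' t) (fun a b h => hw' ⟨(t, a, b), h⟩) s
  have hends : p 0 = p 1 := by
    have h0 := hγ 0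
    have h1 := hγ 1
    simp only [Path.source, Path.target] at h0 h1
    simpa using h0.symm.trans h1
  let H1 : C(I × I, Frame 2 n) :=
    ⟨fun st => ⟨_, hl1 st.1 st.2⟩, Frame.continuous_mk_pair
      (show Continuous fun st : I × I => (1 - (st.1 : ℝ)) • p st.2 0 + (st.1 : ℝ) • w by fun_prop)
      (show Continuous fun st : I × I => p st.2 1 by fun_prop)⟩
  let H2 : C(I × I, Frame 2 n) :=
    ⟨fun st => ⟨_, hl2 st.1 st.2⟩, Frame.continuous_mk_pair
      (show Continuous fun _ : I × I => w by fun_prop)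
      (show Continuous fun st : I × I => (1 - (st.1 : ℝ)) • p st.2 1 + (st.1 : ℝ) • w' by
        fun_prop)⟩
  have hH1 : ∀ s, H1 (s, 0) = H1 (s, 1) := fun s => by
    apply Frame.ext_pair <;> simp [H1, hends]
  have hH2 : ∀ s, H2 (s, 0) = H2 (s, 1) := fun s => by
    apply Frame.ext_pair <;> simp [H2, hends]
  let γ₁ : Path (H2 (0, 0)) (H2 (0, 0)) :=
    ⟨⟨fun t => H2 (0, t), by fun_prop⟩, rfl, (hH2 0).symm⟩
  refine Path.homotopic_refl_of_freeHomotopy (γ' := γ₁) H1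
    (fun t => ?_) (fun t => ?_) hH1 (Path.homotopic_refl_of_freeHomotopy
      (γ' := Path.refl (H2 (1, 0))) H2 (fun t => rfl) (fun t => ?_) hH2 (Path.Homotopic.refl _))
  · apply Subtype.ext
    rw [hγ t, ← hpair (p t)]
    simp [H1]
  · apply Frame.ext_pair <;> simp [γ₁, H1, H2]
  · apply Frame.ext_pair <;> simp [H2]

theorem Continuous.crossProduct {T : Type*} [TopologicalSpace T] {f g : T → Fin 3 → ℝ}
    (hf : Continuous f) (hg : Continuous g) :
    Continuous fun t => _root_.crossProduct (f t) (g t) := by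
  simp only [cross_apply]
  refine continuous_pi fun i => ?_
  fin_cases i <;> dsimp <;> fun_prop

namespace Gr

/-- The plane orthogonal to a nonzero vector of `ℝ³`. -/
def perp (u : {u : Fin 3 → ℝ // u ≠ 0}) : Gr 2 3 :=
  ⟨LinearMap.ker (dotProductBilin ℝ ℝ u.1), by
    have : dotProductBilin ℝ ℝ u.1 ≠ 0 := fun h => u.2 (by
      have := LinearMap.congr_fun h u.1
      simpa [dotProduct_self_eq_zero] using this)
    have := Module.Dual.finrank_ker_add_one_of_ne_zero this
    simp at this; omega⟩

theorem mem_perp {u : {u : Fin 3 → ℝ // u ≠ 0}} {z : Fin 3 → ℝ} :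
    z ∈ (perp u).1 ↔ u.1 ⬝ᵥ z = 0 := Iff.rfl

/-- Near `u₀` the orthogonal plane has the continuous frame `u × a`, `u × b`, independent because
`(u × a) × (u × b) = (u · (a × b)) u`. -/
theorem continuous_perp : Continuous perp := by
  refine continuous_iff_continuousAt.2 fun u₀ => ?_
  obtain ⟨a, b, hab⟩ : ∃ a b : Fin 3 → ℝ, u₀.1 ⬝ᵥ crossProduct a b ≠ 0 := by
    obtain ⟨i, hi⟩ := Function.ne_iff.1 u₀.2
    -- Indices are cyclic modulo 3, so `a × b` is the basis vector `eᵢ`.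
    refine ⟨Pi.single (i + 1) 1, Pi.single (i + 2) 1, ?_⟩
    rw [vec3_dotProduct, cross_apply]
    fin_cases i <;> simpa [Pi.single_apply] using hi
  let U : Set {u : Fin 3 → ℝ // u ≠ 0} := {u | u.1 ⬝ᵥ crossProduct a b ≠ 0}
  have hU : IsOpen U := by
    refine isOpen_ne.preimage (f := fun u : {u : Fin 3 → ℝ // u ≠ 0} => u.1 ⬝ᵥ crossProduct a b) ?_
    exact continuous_subtype_val.dotProduct continuous_const
  have hcc : ∀ u : Fin 3 → ℝ, crossProduct (crossProduct u a) (crossProduct u b)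
      = (u ⬝ᵥ crossProduct a b) • u := fun u => by
    rw [vec3_dotProduct]
    ext i; fin_cases i <;> simp [cross_apply] <;> ring
  let s : U → Frame 2 3 := fun u => ⟨![crossProduct u.1.1 a, crossProduct u.1.1 b],
    crossProduct_ne_zero_iff_linearIndependent.1 (by
      rw [hcc]; exact smul_ne_zero u.2 u.1.2)⟩
  have hs : Continuous s := by
    have hv : Continuous fun u : U => u.1.1 := by fun_prop
    exact Frame.continuous_mk_pair (hv.crossProduct continuous_const)
      (hv.crossProduct continuous_const)
  have hperp : ofFrame ∘ s = perp ∘ ((↑) : U → _) := by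
    funext u
    refine ofFrame_eq_of_mem fun i => mem_perp.2 ?_
    fin_cases i
    exacts [dot_self_cross _ _, dot_self_cross _ _]
  refine (hU.isOpenEmbedding_subtypeVal.continuousAt_iff (x := ⟨u₀, hab⟩)).1 ?_
  rw [← hperp]
  exact (isQuotientMap_ofFrame.continuous.comp hs).continuousAt

/-- A loop of planes in `ℝⁿ`, `n ≥ 3`, that lifts to a loop of frames is null-homotopic. -/
theorem map_ofFrame_homotopic_refl {n : ℕ} (hn : 3 ≤ n) {v : Frame 2 n} (γ : Path v v) :
    (γ.map isQuotientMap_ofFrame.continuous).Homotopic (Path.refl (ofFrame v)) := by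
  rcases hn.lt_or_eq with hn | rfl
  · exact (Frame.homotopic_refl hn γ).map ⟨ofFrame, isQuotientMap_ofFrame.continuous⟩
  -- Frames of planes in `ℝ³` are not simply connected, but their span factors through the cross
  -- product into `ℝ³ ∖ 0`, which is.
  · have := simplyConnectedSpace_ne_zero le_rfl
    let c : Frame 2 3 → {u : Fin 3 → ℝ // u ≠ 0} := fun v =>
      ⟨crossProduct (v.1 0) (v.1 1),
        crossProduct_ne_zero_iff_linearIndependent.2 v.pair_linearIndependent⟩
    have hc : Continuous c := by
      exact Continuous.subtype_mk
        ((Frame.continuous_apply 0).crossProduct (Frame.continuous_apply 1)) _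
    have hpc : ∀ v, perp (c v) = ofFrame v := fun v => by
      refine (ofFrame_eq_of_mem fun i => mem_perp.2 ?_).symm
      rw [dotProduct_comm]
      fin_cases i
      exacts [dot_self_cross _ _, dot_cross_self _ _]
    have h := ((SimplyConnectedSpace.paths_homotopic (γ.map hc) (Path.refl _)).map
      ⟨perp, continuous_perp⟩).pathCast (x₂ := ofFrame v) (x₃ := ofFrame v)
        (hpc v).symm (hpc v).symm
    convert h using 1
    · ext t; exact (hpc _).symm
    · ext t; exact (hpc _).symm

end Gr

end FrameLoops

/-! ### Projective space and its double cover by the sphere -/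

section ProjectiveSpace

open unitInterval Topology

variable {V : Type*} [NormedAddCommGroup V] [NormedSpace ℝ V]

theorem Projectivization.isQuotientMap_mk' :
    IsQuotientMap (Projectivization.mk' ℝ : {v : V // v ≠ 0} → Projectivization ℝ V) :=
  isQuotientMap_quotient_mk'

/-- Radial projection onto the unit sphere. -/
noncomputable def sphereNormalize (v : {v : V // v ≠ 0}) : Metric.sphere (0 : V) 1 :=
  ⟨‖v.1‖⁻¹ • v.1, by
    simp [norm_smul, inv_mul_cancel₀ (norm_ne_zero_iff.2 v.2)]⟩

theorem continuous_sphereNormalize :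
    Continuous (sphereNormalize : {v : V // v ≠ 0} → Metric.sphere (0 : V) 1) :=
  Continuous.subtype_mk ((continuous_subtype_val.norm.inv₀ fun v => norm_ne_zero_iff.2 v.2).smul
    continuous_subtype_val) _

/-- The line spanned by a vector of the unit sphere. -/
noncomputable def sphereToProjectivization (u : Metric.sphere (0 : V) 1) : Projectivization ℝ V :=
  Projectivization.mk' ℝ ⟨u.1, ne_zero_of_mem_unit_sphere u⟩

theorem sphereToProjectivization_normalize (v : {v : V // v ≠ 0}) :
    sphereToProjectivization (sphereNormalize v) = Projectivization.mk' ℝ v :=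
  (Projectivization.mk_eq_mk_iff' ..).2 ⟨‖v.1‖⁻¹, rfl⟩

theorem isQuotientMap_sphereToProjectivization :
    IsQuotientMap (sphereToProjectivization : Metric.sphere (0 : V) 1 → Projectivization ℝ V) := by
  refine IsQuotientMap.of_comp continuous_sphereNormalize
    (Projectivization.isQuotientMap_mk'.continuous.comp (by fun_prop)) ?_
  have : sphereToProjectivization ∘ sphereNormalize = Projectivization.mk' ℝ (V := V) :=
    funext sphereToProjectivization_normalize
  rw [this]
  exact Projectivization.isQuotientMap_mk'

/-- The action of the signs `±1` on the unit sphere. -/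
@[reducible]
def sphereSignAction : MulAction ℤˣ (Metric.sphere (0 : V) 1) where
  smul ε u := ⟨(ε : ℤ) • u.1, by
    rcases Int.units_eq_one_or ε with rfl | rfl <;> simp⟩
  one_smul u := Subtype.ext (one_smul ℤ u.1)
  mul_smul ε ε' u := Subtype.ext (mul_smul (ε : ℤ) (ε' : ℤ) u.1)

theorem sphereToProjectivization_eq_iff {u w : Metric.sphere (0 : V) 1} :
    sphereToProjectivization u = sphereToProjectivization w ↔ u.1 = w.1 ∨ u.1 = -w.1 := by
  refine (Projectivization.mk_eq_mk_iff' ..).trans ⟨?_, ?_⟩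
  · rintro ⟨a, ha⟩
    have : |a| = 1 := by
      have := congrArg norm ha
      simpa [norm_smul] using this
    rcases eq_or_eq_neg_of_abs_eq this with rfl | rfl
    · left; simpa using ha.symm
    · right; simpa using ha.symm
  · rintro (h | h)
    exacts [⟨1, by simp [h]⟩, ⟨-1, by simp [h]⟩]

/-- The map is the quotient by the free antipodal action. Any norm on `V` will do; on `Fin (k + 1) →
ℝ` it is the sup norm. -/
theorem isCoveringMap_sphereToProjectivization :
    IsCoveringMap (sphereToProjectivization : Metric.sphere (0 : V) 1 → Projectivization ℝ V) := by
  let := sphereSignAction (V := V)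
  have hval : ∀ (ε : ℤˣ) (u : Metric.sphere (0 : V) 1), (ε • u).1 = (ε : ℤ) • u.1 :=
    fun _ _ => rfl
  suffices h : IsQuotientCoveringMap
      (sphereToProjectivization : Metric.sphere (0 : V) 1 → Projectivization ℝ V) ℤˣ from
    h.isCoveringMap
  refine
    ⟨isQuotientMap_sphereToProjectivization, ⟨fun ε => ?_⟩, fun {u w} => ?_, fun u => ?_⟩
  · refine continuous_induced_rng.2 ?_
    change Continuous fun u : Metric.sphere (0 : V) 1 => (ε : ℤ) • u.1
    fun_prop
  · rw [sphereToProjectivization_eq_iff]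
    constructor
    · rintro (h | h)
      · exact ⟨1, Subtype.ext (by simp [h])⟩
      · exact ⟨-1, Subtype.ext (by change ((-1 : ℤˣ) • w).1 = _; simp [hval, h])⟩
    · rintro ⟨ε, rfl⟩
      rcases Int.units_eq_one_or ε with rfl | rfl
      · left; simp
      · right; change ((-1 : ℤˣ) • w).1 = _; simp [hval]
  · refine ⟨Metric.ball u 1, Metric.ball_mem_nhds _ one_pos, ?_⟩
    rintro ε ⟨_, ⟨w, hw, rfl⟩, hw'⟩
    rcases Int.units_eq_one_or ε with rfl | rfl
    · rfl
    · exfalso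
      rw [Metric.mem_ball, Subtype.dist_eq, dist_eq_norm] at hw hw'
      change ‖((-1 : ℤˣ) • w).1 - u.1‖ < 1 at hw'
      rw [hval] at hw'
      -- If `w` and `-w` both lay within `1` of `u`, then `2u` would have norm less than `2`.
      have h1 : ‖(2 : ℝ) • u.1‖ = 2 := by simp [norm_smul]
      have h2 : (2 : ℝ) • u.1 = -((w.1 - u.1) + ((((-1 : ℤˣ) : ℤ) • w.1) - u.1)) := by
        simp [two_smul]
      rw [h2, norm_neg] at h1
      linarith [norm_add_le (w.1 - u.1) ((((-1 : ℤˣ) : ℤ) • w.1) - u.1)]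

/-- Lifts to the sphere of homotopic paths of lines have the same target if they have the same
source. -/
theorem sphere_lift_target_eq {x y : Projectivization ℝ V} {γ γ' : Path x y}
    (h : γ.Homotopic γ') {Γ Γ' : C(I, Metric.sphere (0 : V) 1)}
    (hΓ : ∀ t, sphereToProjectivization (Γ t) = γ t)
    (hΓ' : ∀ t, sphereToProjectivization (Γ' t) = γ' t) (h0 : Γ 0 = Γ' 0) : Γ 1 = Γ' 1 := by
  have cov := isCoveringMap_sphereToProjectivization (V := V)
  have e1 := (cov.eq_liftPath_iff' (γ := γ.toContinuousMap) (e := Γ 0) (hΓ 0).symm).2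
    ⟨funext hΓ, rfl⟩
  have e2 := (cov.eq_liftPath_iff' (γ := γ'.toContinuousMap) (e := Γ 0)
    (by rw [h0]; exact (hΓ' 0).symm)).2 ⟨funext hΓ', h0.symm⟩
  rw [e1, e2]
  exact cov.liftPath_apply_one_eq_of_homotopicRel h _ _ _

/-- Paths in `ℝPᵏ`, `k ≥ 2`, whose lifts to the sphere have the same endpoints are homotopic. -/
theorem RP.homotopic_of_lifts {k : ℕ} (hk : 2 ≤ k) {x y : RP k} {γ γ' : Path x y}
    {Γ Γ' : C(I, Metric.sphere (0 : Fin (k + 1) → ℝ) 1)}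
    (hΓ : ∀ t, sphereToProjectivization (Γ t) = γ t)
    (hΓ' : ∀ t, sphereToProjectivization (Γ' t) = γ' t) (h0 : Γ 0 = Γ' 0) (h1 : Γ 1 = Γ' 1) :
    γ.Homotopic γ' := by
  have := simplyConnectedSpace_ne_zero (n := k + 1) (by omega)
  let ι : Metric.sphere (0 : Fin (k + 1) → ℝ) 1 → {v : Fin (k + 1) → ℝ // v ≠ 0} :=
    fun u => ⟨u.1, ne_zero_of_mem_unit_sphere u⟩
  have hι : Continuous ι := by fun_prop
  let p : Path (ι (Γ 0)) (ι (Γ 1)) := ⟨⟨fun t => ι (Γ t), by fun_prop⟩, rfl, rfl⟩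
  let p' : Path (ι (Γ 0)) (ι (Γ 1)) :=
    ⟨⟨fun t => ι (Γ' t), by fun_prop⟩, by simp [h0], by simp [h1]⟩
  have h := ((SimplyConnectedSpace.paths_homotopic p p').map
    ⟨_, Projectivization.isQuotientMap_mk'.continuous⟩).pathCast (x₂ := x) (x₃ := y)
      (by rw [← γ.source]; exact (hΓ 0).symm) (by rw [← γ.target]; exact (hΓ 1).symm)
  convert h using 1
  · ext t; exact (hΓ t).symm
  · ext t; exact (hΓ' t).symm

theorem sphereNormalize_smul_of_neg {v w : {v : V // v ≠ 0}} {c : ℝ} (hc : c < 0)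
    (h : w.1 = c • v.1) : (sphereNormalize w).1 = -(sphereNormalize v).1 := by
  have hv := norm_ne_zero_iff.2 v.2
  simp only [sphereNormalize, h, norm_smul, Real.norm_of_nonpos hc.le, ← neg_smul, smul_smul]
  congr 1
  field_simp [hc.ne]

end ProjectiveSpace

/-! ### Alternating bilinear maps and fundamental groups -/

section PluckerType

open unitInterval Topology Matrix

variable {n k : ℕ}

/-- The maps on pairs of vectors that are multiplied by the determinant under a linear
substitution, that is, the alternating bilinear maps. -/
def HasDetProperty {V W : Type*} [AddCommGroup V] [Module ℝ V] [AddCommGroup W] [Module ℝ W]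
    (μ : V → V → W) : Prop :=
  ∀ (a b c d : ℝ) (x y : V),
    μ (a • x + b • y) (c • x + d • y) = (a * d - b * c) • μ x y

theorem hasDetProperty_of_bilinear {V W : Type*} [AddCommGroup V] [Module ℝ V] [AddCommGroup W]
    [Module ℝ W] {μ : V → V → W} (hadd : ∀ x y z, μ (x + y) z = μ x z + μ y z)
    (hsmul : ∀ (a : ℝ) x y, μ (a • x) y = a • μ x y) (hneg : ∀ x y, μ x y = -μ y x) :
    HasDetProperty μ := by
  have hadd' : ∀ x y z, μ x (y + z) = μ x y + μ x z := fun x y z => by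
    rw [hneg, hadd, hneg y, hneg z]; abel
  have hsmul' : ∀ (a : ℝ) x y, μ x (a • y) = a • μ x y := fun a x y => by
    rw [hneg, hsmul, hneg y, smul_neg, neg_neg]
  have hself : ∀ x, μ x x = 0 := fun x => by
    have h : (2 : ℝ) • μ x x = 0 := by
      rw [two_smul]; exact eq_neg_iff_add_eq_zero.1 (hneg x x)
    exact (smul_eq_zero.1 h).resolve_left two_ne_zero
  intro a b c d x y
  rw [hadd, hadd', hadd']
  simp only [hsmul, hsmul', hself, hneg y x]
  module

/-- A frame of a plane in `ℝⁿ`, `n ≥ 3`, can be moved to a frame of the same plane with the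
opposite orientation. -/
theorem Frame.exists_path_flip (hn : 3 ≤ n) (v : Frame 2 n) :
    ∃ Γ : C(I, Frame 2 n), Γ 0 = v ∧ (Γ 1).1 0 = v.1 0 ∧ (Γ 1).1 1 = -v.1 1 := by
  have hx : v.1 0 ≠ 0 := v.2.ne_zero 0
  -- The complement of a line in `ℝⁿ`, `n ≥ 3`, is path connected, so the second vector can travel
  -- to its negative while the first stays fixed.
  have hpc : IsPathConnected ((Submodule.span ℝ {v.1 0} : Submodule ℝ (Fin n → ℝ)) :
      Set (Fin n → ℝ))ᶜ := by
    refine isPathConnected_compl_of_one_lt_codim ?_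
    have h := Submodule.finrank_quotient_add_finrank (Submodule.span ℝ {v.1 0})
    rw [finrank_span_singleton hx, Module.finrank_fin_fun] at h
    rw [← Module.finrank_eq_rank]
    exact_mod_cast (by omega : 1 < _)
  have hmem : ∀ {y : Fin n → ℝ}, y ∈ ((Submodule.span ℝ {v.1 0} : Submodule ℝ (Fin n → ℝ)) :
      Set (Fin n → ℝ))ᶜ ↔ LinearIndependent ℝ ![v.1 0, y] := fun {y} => by
    rw [LinearIndependent.pair_iff' hx, Set.mem_compl_iff, SetLike.mem_coe,
      Submodule.mem_span_singleton, not_exists]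
  have hy := hmem.2 v.pair_linearIndependent
  have hj := hpc.joinedIn _ hy (-v.1 1) (by
    rw [Set.mem_compl_iff, SetLike.mem_coe, neg_mem_iff]; exact hy)
  refine ⟨⟨fun t => ⟨_, hmem.1 (hj.somePath_mem t)⟩, Frame.continuous_mk_pair
    (show Continuous fun _ : I => v.1 0 by fun_prop) hj.somePath.continuous⟩, ?_, rfl, ?_⟩
  · apply Frame.ext_pair <;> simp
  · simp

/-- A map from the Grassmannian of planes of `ℝⁿ`, `n ≥ 3`, to `ℝPᵏ`, `k ≥ 2`, given by an
alternating bilinear map is a `π₁`-isomorphism. -/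
theorem IsGivenBy.isPi1Iso (hn : 3 ≤ n) (hk : 2 ≤ k) {f : C(Gr 2 n, RP k)}
    {μ : (Fin n → ℝ) → (Fin n → ℝ) → (Fin (k + 1) → ℝ)} (hf : IsGivenBy f μ)
    (hμ : HasDetProperty μ) (hc : Continuous fun p : (Fin n → ℝ) × (Fin n → ℝ) => μ p.1 p.2) :
    IsPi1Iso f := by
  let F : Frame 2 n → {w : Fin (k + 1) → ℝ // w ≠ 0} := fun v => ⟨μ (v.1 0) (v.1 1), (hf v).1⟩
  have hF : Continuous F :=
    (hc.comp ((Frame.continuous_apply 0).prodMk (Frame.continuous_apply 1))).subtype_mk _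
  let u : C(Frame 2 n, Metric.sphere (0 : Fin (k + 1) → ℝ) 1) :=
    ⟨fun v => sphereNormalize (F v), continuous_sphereNormalize.comp hF⟩
  have hu : ∀ v, sphereToProjectivization (u v) = f (Gr.ofFrame v) := fun v => by
    rw [(hf v).2]; exact sphereToProjectivization_normalize (F v)
  have hu_neg : ∀ (v : Frame 2 n) (M : Matrix (Fin 2) (Fin 2) ℝ) (hM : M.det < 0),
      (u (v.act M hM.ne)).1 = -(u v).1 := fun v M hM => by
    refine sphereNormalize_smul_of_neg hM ?_
    change μ _ _ = _ • μ _ _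
    rw [Frame.act_zero, Frame.act_one, hμ, det_fin_two]
  intro x
  obtain ⟨v, rfl⟩ := Gr.ofFrame_surjective x
  constructor
  · rw [injective_iff_map_eq_one]
    intro g hg
    obtain ⟨γ, rfl⟩ := Path.Homotopic.Quotient.mk_surjective g
    have hhom : (γ.map f.continuous).Homotopic (Path.refl _) :=
      Path.Homotopic.Quotient.exact hg
    obtain ⟨Γ, hΓ, hΓ0⟩ := Gr.exists_path_lift γ.toContinuousMap v γ.source
    have hΓ' : ∀ t, Gr.ofFrame (Γ t) = γ t := fun t => congrFun hΓ t
    obtain ⟨M, hM, hΓ1⟩ := Gr.exists_act_of_ofFrame_eq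
      (v := v) (w := Γ 1) (by rw [hΓ', γ.target])
    -- The image loop is null-homotopic, so its lift ends where the constant lift does. A negative
    -- determinant would make it end at the antipode.
    have hend : u (Γ 1) = u v :=
      sphere_lift_target_eq hhom (Γ := u.comp Γ) (Γ' := ContinuousMap.const I (u v))
        (fun t => (hu _).trans (congrArg f (hΓ' t))) (fun t => hu v) (by simp [hΓ0])
    have hpos : 0 < M.det := by
      refine hM.lt_or_gt.resolve_left fun hneg => ?_
      have h := hu_neg v M hneg
      rw [← hΓ1, hend, self_eq_neg] at h
      exact ne_zero_of_mem_unit_sphere (u v) h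
    obtain ⟨Γ', hΓ'v⟩ := Frame.exists_loop Γ hΓ0 hpos hΓ1
    refine Path.Homotopic.Quotient.eq.2 ?_
    have h := Gr.map_ofFrame_homotopic_refl hn Γ'
    convert h using 1
    ext t
    exact ((hΓ'v t).trans (hΓ' t)).symm
  · intro g
    obtain ⟨δ, rfl⟩ := Path.Homotopic.Quotient.mk_surjective g
    have cov := isCoveringMap_sphereToProjectivization (V := Fin (k + 1) → ℝ)
    obtain ⟨Δ, hΔ, hΔ0⟩ := cov.exists_path_lifts δ.toContinuousMap (u v)
      (δ.source.trans (hu v).symm)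
    have hΔ' : ∀ t, sphereToProjectivization (Δ t) = δ t := fun t => congrFun hΔ t
    have hΔ1 := sphereToProjectivization_eq_iff.1 ((hΔ' 1).trans (δ.target.trans (hu v).symm))
    -- The lift of `δ` ends at `u v` or at its antipode; a constant path or an orientation flip of
    -- `v` realizes the same endpoint.
    obtain ⟨Γ, hΓ0, hΓl, hΓ1⟩ : ∃ Γ : C(I, Frame 2 n), Γ 0 = v ∧
        Gr.ofFrame (Γ 1) = Gr.ofFrame v ∧ u (Γ 1) = Δ 1 := by
      rcases hΔ1 with h | h
      · exact ⟨ContinuousMap.const I v, rfl, rfl, Subtype.ext h.symm⟩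
      · obtain ⟨Γ, h0, hx, hy⟩ := Frame.exists_path_flip hn v
        have hM : (!![1, 0; 0, -1] : Matrix (Fin 2) (Fin 2) ℝ).det < 0 := by
          rw [det_fin_two_of]; norm_num
        have hact : Γ 1 = v.act _ hM.ne := Frame.ext_pair (by simp [hx]) (by simp [hy])
        refine ⟨Γ, h0, by rw [hact, Gr.ofFrame_act], Subtype.ext ?_⟩
        rw [hact, hu_neg v _ hM, h]
    let γ : Path (Gr.ofFrame v) (Gr.ofFrame v) :=
      ⟨⟨fun t => Gr.ofFrame (Γ t), Gr.isQuotientMap_ofFrame.continuous.comp Γ.continuous⟩,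
        by simp [hΓ0], hΓl⟩
    refine ⟨Path.Homotopic.Quotient.mk γ, Path.Homotopic.Quotient.eq.2 ?_⟩
    exact RP.homotopic_of_lifts hk (Γ := u.comp Γ) (Γ' := Δ) (fun t => hu _) hΔ'
      (by simp [hΓ0, hΔ0]) hΓ1

/-- An alternating bilinear map that does not vanish on linearly independent pairs defines a
continuous map from the Grassmannian of planes to a projective space. -/
theorem exists_isGivenBy {μ : (Fin n → ℝ) → (Fin n → ℝ) → (Fin (k + 1) → ℝ)}
    (hμ : HasDetProperty μ) (hc : Continuous fun p : (Fin n → ℝ) × (Fin n → ℝ) => μ p.1 p.2)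
    (hne : ∀ x y, LinearIndependent ℝ ![x, y] → μ x y ≠ 0) :
    ∃ f : C(Gr 2 n, RP k), IsGivenBy f μ := by
  let F : Frame 2 n → {w : Fin (k + 1) → ℝ // w ≠ 0} := fun v =>
    ⟨μ (v.1 0) (v.1 1), hne _ _ v.pair_linearIndependent⟩
  have hF : Continuous F :=
    (hc.comp ((Frame.continuous_apply 0).prodMk (Frame.continuous_apply 1))).subtype_mk _
  choose r hr using (Gr.ofFrame_surjective : Function.Surjective (Gr.ofFrame : Frame 2 n → Gr 2 n))
  let g : Gr 2 n → RP k := fun W => Projectivization.mk' ℝ (F (r W))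
  have hg : ∀ v, g (Gr.ofFrame v) = Projectivization.mk' ℝ (F v) := fun v => by
    obtain ⟨M, hM, h⟩ := Gr.exists_act_of_ofFrame_eq (hr (Gr.ofFrame v)).symm
    refine (Projectivization.mk_eq_mk_iff' ..).2 ⟨M.det, ?_⟩
    rw [h, Frame.act_zero, Frame.act_one, hμ, det_fin_two]
  refine ⟨⟨g, Gr.isQuotientMap_ofFrame.continuous_iff.2 ?_⟩, fun v => ⟨(F v).2, hg v⟩⟩
  have : g ∘ Gr.ofFrame = Projectivization.mk' ℝ ∘ F := funext hg
  rw [this]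
  exact Projectivization.isQuotientMap_mk'.continuous.comp hF

theorem IsPi1Iso.comp {X Y Z : Type*} [TopologicalSpace X] [TopologicalSpace Y]
    [TopologicalSpace Z] {g : C(Y, Z)} {f : C(X, Y)} (hg : IsPi1Iso g) (hf : IsPi1Iso f) :
    IsPi1Iso (g.comp f) := fun x => by
  have : ⇑(FundamentalGroup.map (g.comp f) x) =
      FundamentalGroup.map g (f x) ∘ FundamentalGroup.map f x := by
    funext p
    obtain ⟨γ, rfl⟩ := Path.Homotopic.Quotient.mk_surjective p
    rfl
  rw [this]
  exact (hg _).comp (hf x)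

theorem IsPi1Iso.of_comp {X Y Z : Type*} [TopologicalSpace X] [TopologicalSpace Y]
    [TopologicalSpace Z] {g : C(Y, Z)} {f : C(X, Y)} (hg : IsPi1Iso g)
    (hgf : IsPi1Iso (g.comp f)) : IsPi1Iso f := fun x => by
  have : ⇑(FundamentalGroup.map (g.comp f) x) =
      FundamentalGroup.map g (f x) ∘ FundamentalGroup.map f x := by
    funext p
    obtain ⟨γ, rfl⟩ := Path.Homotopic.Quotient.mk_surjective p
    rfl
  have h := hgf x
  rw [this] at h
  exact (Function.Bijective.of_comp_iff' (hg _) _).1 h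

/-- If some alternating bilinear map defines a map on the planes of `ℝⁿ`, then the inclusions
into the Grassmannian of planes of `ℝⁿ` are `π₁`-isomorphisms. -/
theorem IsGivenBy.isPi1Iso_incl (hk : 2 ≤ k) {f : C(Gr 2 n, RP k)}
    {μ : (Fin n → ℝ) → (Fin n → ℝ) → (Fin (k + 1) → ℝ)} (hf : IsGivenBy f μ)
    (hμ : HasDetProperty μ) (hc : Continuous fun p : (Fin n → ℝ) × (Fin n → ℝ) => μ p.1 p.2)
    {m : ℕ} (hm : 2 < m) (L : (Fin m → ℝ) →ₗ[ℝ] (Fin n → ℝ)) (hL : Function.Injective L) :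
    IsPi1Iso (Gr.incl (d := 2) L hL) := by
  have hmn : m ≤ n := by simpa using LinearMap.finrank_le_finrank_of_injective hL
  -- Two out of three: `f` and its composite with the inclusion are both given by alternating maps,
  -- `μ` and its restriction along `L`.
  refine IsPi1Iso.of_comp (hf.isPi1Iso (hm.trans_le hmn) hk hμ hc) ?_
  have hLc := L.continuous_of_finiteDimensional
  refine IsGivenBy.isPi1Iso (μ := fun x y => μ (L x) (L y)) hm hk (fun v => ?_)
    (fun a b c d x y => by simp only [map_add, map_smul, hμ a b c d])
    (hc.comp ((hLc.comp continuous_fst).prodMk (hLc.comp continuous_snd)))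
  obtain ⟨h, e⟩ := hf (Gr.mapFrame L hL v)
  exact ⟨h, (congrArg f (Gr.mapFun_ofFrame L hL v)).trans e⟩

end PluckerType

/-! ### The quaternion and octonion formulas -/

section Formulas

open Matrix

/-- The equality case of Cauchy–Schwarz: `|(x·x) y - (x·y) x|² = (x·x) ((x·x)(y·y) - (x·y)²)`. -/
theorem dotProduct_self_smul_eq {n : ℕ} {x y : Fin n → ℝ}
    (h : (x ⬝ᵥ y) ^ 2 = (x ⬝ᵥ x) * (y ⬝ᵥ y)) : (x ⬝ᵥ x) • y = (x ⬝ᵥ y) • x := by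
  rw [← sub_eq_zero, ← dotProduct_self_eq_zero]
  simp only [sub_dotProduct, dotProduct_sub, smul_dotProduct, dotProduct_smul, smul_eq_mul,
    dotProduct_comm y x]
  linear_combination -(x ⬝ᵥ x) * h

theorem muH_eq (x y : Fin 4 → ℝ) : muH x y =
    ![x 0 * y 1 - y 0 * x 1 + x 2 * y 3 - x 3 * y 2,
      x 0 * y 2 - y 0 * x 2 + x 3 * y 1 - x 1 * y 3,
      x 0 * y 3 - y 0 * x 3 + x 1 * y 2 - x 2 * y 1] := by
  have h0 : ∀ x, (toQuat x).re = x 0 := fun _ => rfl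
  have h1 : ∀ x, (toQuat x).imI = x 1 := fun _ => rfl
  have h2 : ∀ x, (toQuat x).imJ = x 2 := fun _ => rfl
  have h3 : ∀ x, (toQuat x).imK = x 3 := fun _ => rfl
  ext i
  fin_cases i <;> simp [muH, h0, h1, h2, h3] <;> ring

theorem muH_hasDetProperty : HasDetProperty muH := by
  refine hasDetProperty_of_bilinear (fun x y z => ?_) (fun a x y => ?_) (fun x y => ?_) <;>
    ext i <;> fin_cases i <;> simp [muH_eq] <;> ring

theorem continuous_muH : Continuous fun p : (Fin 4 → ℝ) × (Fin 4 → ℝ) => muH p.1 p.2 := by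
  simp only [muH_eq]
  refine continuous_pi fun i => ?_
  fin_cases i <;> dsimp <;> fun_prop

/-- `muH x y` is the pure part of `y x̄`, which has norm `|x||y|` and real part `x·y`. So its
vanishing is equality in Cauchy–Schwarz. -/
theorem muH_ne_zero (x y : Fin 4 → ℝ) (h : LinearIndependent ℝ ![x, y]) : muH x y ≠ 0 := by
  intro h0
  have hn : muH x y ⬝ᵥ muH x y = (x ⬝ᵥ x) * (y ⬝ᵥ y) - (x ⬝ᵥ y) ^ 2 := by
    rw [muH_eq]
    simp [dotProduct, Fin.sum_univ_succ]
    ring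
  rw [h0, dotProduct_zero] at hn
  have hd := dotProduct_self_smul_eq (x := x) (y := y) (by linarith)
  have := (LinearIndependent.pair_iff.1 h (x ⬝ᵥ y) (-(x ⬝ᵥ x)) (by rw [← hd]; simp)).2
  exact h.ne_zero 0 (dotProduct_self_eq_zero.1 (neg_eq_zero.1 this))

theorem octMul_add_left (x y z : Fin 8 → ℝ) : octMul (x + y) z = octMul x z + octMul y z := by
  ext i; fin_cases i <;> simp [octMul] <;> ring

theorem octMul_add_right (x y z : Fin 8 → ℝ) : octMul x (y + z) = octMul x y + octMul x z := by
  ext i; fin_cases i <;> simp [octMul] <;> ring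

theorem octMul_smul_left (a : ℝ) (x y : Fin 8 → ℝ) : octMul (a • x) y = a • octMul x y := by
  ext i; fin_cases i <;> simp [octMul] <;> ring

theorem octMul_smul_right (a : ℝ) (x y : Fin 8 → ℝ) : octMul x (a • y) = a • octMul x y := by
  ext i; fin_cases i <;> simp [octMul] <;> ring

theorem octMul_sub_right (x y z : Fin 8 → ℝ) : octMul x (y - z) = octMul x y - octMul x z := by
  rw [sub_eq_add_neg, octMul_add_right, ← neg_one_smul ℝ z, octMul_smul_right, neg_one_smul,
    sub_eq_add_neg]

theorem Continuous.octMul {T : Type*} [TopologicalSpace T] {f g : T → Fin 8 → ℝ}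
    (hf : Continuous f) (hg : Continuous g) : Continuous fun t => _root_.octMul (f t) (g t) := by
  refine continuous_pi fun i => ?_
  fin_cases i <;> simp only [_root_.octMul] <;> dsimp <;> fun_prop

/-- The norm of the octonions is multiplicative. -/
theorem octMul_dotProduct_self (x y : Fin 8 → ℝ) :
    octMul x y ⬝ᵥ octMul x y = (x ⬝ᵥ x) * (y ⬝ᵥ y) := by
  simp [dotProduct, Fin.sum_univ_succ, octMul]
  ring

theorem octMul_eq_zero {x y : Fin 8 → ℝ} (h : octMul x y = 0) (hx : x ≠ 0) : y = 0 := by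
  have := octMul_dotProduct_self x y
  rw [h, dotProduct_zero] at this
  rcases mul_eq_zero.1 this.symm with h | h
  exacts [absurd (dotProduct_self_eq_zero.1 h) hx, dotProduct_self_eq_zero.1 h]

theorem muO_eq (x y : Fin 8 → ℝ) : muO x y =
    ![x 0 * y 1 - y 0 * x 1 + x 2 * y 3 - x 3 * y 2 + x 4 * y 5 - x 5 * y 4 - x 6 * y 7 + x 7 * y 6,
      x 0 * y 2 - y 0 * x 2 - x 1 * y 3 + x 3 * y 1 + x 4 * y 6 + x 5 * y 7 - x 6 * y 4 - x 7 * y 5,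
      x 0 * y 3 - y 0 * x 3 + x 1 * y 2 - x 2 * y 1 + x 4 * y 7 - x 5 * y 6 + x 6 * y 5 - x 7 * y 4,
      x 0 * y 4 - y 0 * x 4 - x 1 * y 5 - x 2 * y 6 - x 3 * y 7 + x 5 * y 1 + x 6 * y 2 + x 7 * y 3,
      x 0 * y 5 - y 0 * x 5 + x 1 * y 4 - x 2 * y 7 + x 3 * y 6 - x 4 * y 1 - x 6 * y 3 + x 7 * y 2,
      x 0 * y 6 - y 0 * x 6 + x 1 * y 7 + x 2 * y 4 - x 3 * y 5 - x 4 * y 2 + x 5 * y 3 - x 7 * y 1,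
      x 0 * y 7 - y 0 * x 7 - x 1 * y 6 + x 2 * y 5 + x 3 * y 4 - x 4 * y 3 - x 5 * y 2
        + x 6 * y 1] := by
  ext i
  fin_cases i <;> simp [muO, octMul, octConj, Fin.ext_iff] <;> ring

theorem muO_add_left (x y z : Fin 8 → ℝ) : muO (x + y) z = muO x z + muO y z := by
  ext i; fin_cases i <;> simp [muO_eq] <;> ring

theorem muO_smul_left (a : ℝ) (x y : Fin 8 → ℝ) : muO (a • x) y = a • muO x y := by
  ext i; fin_cases i <;> simp [muO_eq] <;> ring

theorem muO_swap (x y : Fin 8 → ℝ) : muO x y = -muO y x := by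
  ext i; fin_cases i <;> simp [muO_eq] <;> ring

theorem muO_hasDetProperty : HasDetProperty muO :=
  hasDetProperty_of_bilinear muO_add_left muO_smul_left muO_swap

theorem Continuous.muO {T : Type*} [TopologicalSpace T] {f g : T → Fin 8 → ℝ}
    (hf : Continuous f) (hg : Continuous g) : Continuous fun t => _root_.muO (f t) (g t) := by
  simp only [muO_eq]
  refine continuous_pi fun i => ?_
  fin_cases i <;> dsimp <;> fun_prop

/-- As for quaternions, `muO x y` is the pure part of `y x̄`. -/
theorem dotProduct_self_smul_eq_of_muO {x y : Fin 8 → ℝ} (h : muO x y = 0) :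
    (x ⬝ᵥ x) • y = (x ⬝ᵥ y) • x := by
  have hn : muO x y ⬝ᵥ muO x y = (x ⬝ᵥ x) * (y ⬝ᵥ y) - (x ⬝ᵥ y) ^ 2 := by
    rw [muO_eq]
    simp [dotProduct, Fin.sum_univ_succ]
    ring
  rw [h, dotProduct_zero] at hn
  exact dotProduct_self_smul_eq (by linarith)

theorem muO_ne_zero (x y : Fin 8 → ℝ) (h : LinearIndependent ℝ ![x, y]) : muO x y ≠ 0 := by
  intro h0
  have hd := dotProduct_self_smul_eq_of_muO h0
  have := (LinearIndependent.pair_iff.1 h (x ⬝ᵥ y) (-(x ⬝ᵥ x)) (by rw [← hd]; simp)).2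
  exact h.ne_zero 0 (dotProduct_self_eq_zero.1 (neg_eq_zero.1 this))

section Pair

variable {d : ℕ}

theorem fstOct_add (x y : Fin (8 + (d + 1)) → ℝ) : fstOct (x + y) = fstOct x + fstOct y := rfl

theorem fstOct_smul (a : ℝ) (x : Fin (8 + (d + 1)) → ℝ) : fstOct (a • x) = a • fstOct x := rfl

theorem sndOct_add (x y : Fin (8 + (d + 1)) → ℝ) : sndOct (x + y) = sndOct x + sndOct y := by
  ext i; by_cases h : (i : ℕ) < d + 1 <;> simp [sndOct, h]

theorem sndOct_smul (a : ℝ) (x : Fin (8 + (d + 1)) → ℝ) : sndOct (a • x) = a • sndOct x := by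
  ext i; by_cases h : (i : ℕ) < d + 1 <;> simp [sndOct, h]

theorem continuous_fstOct : Continuous (fstOct (d := d)) := by
  unfold fstOct; fun_prop

theorem continuous_sndOct : Continuous (sndOct (d := d)) := by
  refine continuous_pi fun i => ?_
  by_cases h : (i : ℕ) < d + 1 <;> simp only [sndOct, h, dite_true, dite_false] <;> fun_prop

theorem eq_of_fstOct_sndOct (hd : d ≤ 7) {x y : Fin (8 + (d + 1)) → ℝ}
    (h1 : fstOct x = fstOct y) (h2 : sndOct x = sndOct y) : x = y := by
  ext i
  refine Fin.addCases (fun i => congrFun h1 i) (fun i => ?_) i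
  have := congrFun h2 ⟨i, by omega⟩
  simpa [sndOct, Nat.lt_succ_iff.1 i.2] using this

theorem muPair_apply_fst (hd : d ≤ 7) (x y : Fin (8 + (d + 1)) → ℝ) (i : Fin 7) :
    muPair d hd x y (Fin.castAdd 8 (Fin.castAdd d i)) = muO (fstOct x) (fstOct y) i := by
  rw [muPair, Fin.append_left, Fin.append_left]

theorem muPair_apply_snd (hd : d ≤ 7) (x y : Fin (8 + (d + 1)) → ℝ) (i : Fin d) :
    muPair d hd x y (Fin.castAdd 8 (Fin.natAdd 7 i)) =
      muO (sndOct x) (sndOct y) (Fin.castLE hd i) := by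
  rw [muPair, Fin.append_left, Fin.append_right]

theorem muPair_apply_mul (hd : d ≤ 7) (x y : Fin (8 + (d + 1)) → ℝ) (i : Fin 8) :
    muPair d hd x y (Fin.natAdd (7 + d) i) =
      octMul (fstOct x) (sndOct y) i - octMul (fstOct y) (sndOct x) i := by
  rw [muPair, Fin.append_right, Pi.sub_apply]

theorem forall_fin_muPair {p : Fin (7 + d + 8) → Prop}
    (h1 : ∀ i : Fin 7, p (Fin.castAdd 8 (Fin.castAdd d i)))
    (h2 : ∀ i : Fin d, p (Fin.castAdd 8 (Fin.natAdd 7 i)))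
    (h3 : ∀ i : Fin 8, p (Fin.natAdd (7 + d) i)) (i : Fin (7 + d + 8)) : p i :=
  Fin.addCases (fun j => Fin.addCases h1 h2 j) h3 i

theorem muPair_hasDetProperty (hd : d ≤ 7) : HasDetProperty (muPair d hd) := by
  refine hasDetProperty_of_bilinear
    (fun x y z => funext (forall_fin_muPair (fun i => ?_) (fun i => ?_) (fun i => ?_)))
    (fun a x y => funext (forall_fin_muPair (fun i => ?_) (fun i => ?_) (fun i => ?_)))
    (fun x y => funext (forall_fin_muPair (fun i => ?_) (fun i => ?_) (fun i => ?_))) <;>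
  simp only [Pi.add_apply, Pi.smul_apply, Pi.neg_apply, muPair_apply_fst, muPair_apply_snd,
    muPair_apply_mul, fstOct_add, sndOct_add, muO_add_left, octMul_add_left, octMul_add_right,
    fstOct_smul, sndOct_smul, muO_smul_left, octMul_smul_left, octMul_smul_right, smul_eq_mul]
  · ring
  · ring
  · rw [muO_swap, Pi.neg_apply]
  · rw [muO_swap, Pi.neg_apply]
  · ring

theorem continuous_muPair (hd : d ≤ 7) :
    Continuous fun p : (Fin (8 + (d + 1)) → ℝ) × (Fin (8 + (d + 1)) → ℝ) =>
      muPair d hd p.1 p.2 := by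
  let E := Fin (8 + (d + 1)) → ℝ
  have f1 : Continuous fun p : E × E => fstOct p.1 := continuous_fstOct.comp continuous_fst
  have f2 : Continuous fun p : E × E => fstOct p.2 := continuous_fstOct.comp continuous_snd
  have s1 : Continuous fun p : E × E => sndOct p.1 := continuous_sndOct.comp continuous_fst
  have s2 : Continuous fun p : E × E => sndOct p.2 := continuous_sndOct.comp continuous_snd
  have c1 : Continuous fun p : E × E => muO (fstOct p.1) (fstOct p.2) :=
    f1.muO f2
  have c2 : Continuous fun p : E × E => muO (sndOct p.1) (sndOct p.2) :=
    s1.muO s2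
  have c3 : Continuous fun p : E × E =>
      octMul (fstOct p.1) (sndOct p.2) - octMul (fstOct p.2) (sndOct p.1) :=
    (f1.octMul s2).sub (f2.octMul s1)
  refine continuous_pi (forall_fin_muPair (fun i => ?_) (fun i => ?_) (fun i => ?_))
  · simpa only [muPair_apply_fst] using continuous_pi_iff.1 c1 i
  · simpa only [muPair_apply_snd] using continuous_pi_iff.1 c2 (Fin.castLE hd i)
  · simpa only [muPair_apply_mul, Pi.sub_apply] using continuous_pi_iff.1 c3 i

/-- The span of `e₀, …, e_d` is closed under the product `muO` if `d` is `0`, `1`, `3` or `7`. -/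
theorem muO_sndOct_eq_zero (hd : d = 0 ∨ d = 1 ∨ d = 3 ∨ d = 7) (x y : Fin (8 + (d + 1)) → ℝ)
    (i : Fin 7) (hi : d ≤ i) : muO (sndOct x) (sndOct y) i = 0 := by
  rcases hd with rfl | rfl | rfl | rfl <;> fin_cases i <;>
    first
    | (exfalso; revert hi; decide)
    | simp [muO_eq, sndOct]

/-- Suppose all components vanish and `x₁ ≠ 0`. The first gives `a y₁ = b x₁` with `a = |x₁|²` and
`b = x₁·y₁`. The last gives `x₁ (a y₂ - b x₂) = (a y₁ - b x₁) x₂ = 0`, so `a y₂ = b x₂` and `x`, `y`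
are dependent. Hence `x₁ = 0` and likewise `y₁ = 0`, and then the second component makes `x₂`, `y₂`
dependent. Associativity plays no role. -/
theorem muPair_ne_zero (hd7 : d ≤ 7) (hd : d = 0 ∨ d = 1 ∨ d = 3 ∨ d = 7)
    (x y : Fin (8 + (d + 1)) → ℝ) (h : LinearIndependent ℝ ![x, y]) : muPair d hd7 x y ≠ 0 := by
  intro h0
  have e1 : muO (fstOct x) (fstOct y) = 0 := by
    ext i
    have := congrFun h0 (Fin.castAdd 8 (Fin.castAdd d i))
    rwa [muPair_apply_fst] at this
  have e2 : muO (sndOct x) (sndOct y) = 0 := by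
    ext i
    by_cases hi : (i : ℕ) < d
    · have := congrFun h0 (Fin.castAdd 8 (Fin.natAdd 7 ⟨i, hi⟩))
      rwa [muPair_apply_snd] at this
    -- `muPair` records only the first `d` coordinates; the others vanish because `e₀, …, e_d` span
    -- a subalgebra.
    · exact muO_sndOct_eq_zero hd x y i (not_lt.1 hi)
  have e3 : octMul (fstOct x) (sndOct y) = octMul (fstOct y) (sndOct x) := by
    rw [← sub_eq_zero]
    ext i
    have := congrFun h0 (Fin.natAdd (7 + d) i)
    rwa [muPair_apply_mul] at this
  have key : ∀ x y : Fin (8 + (d + 1)) → ℝ, LinearIndependent ℝ ![x, y] →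
      muO (fstOct x) (fstOct y) = 0 →
      octMul (fstOct x) (sndOct y) = octMul (fstOct y) (sndOct x) → fstOct x = 0 := by
    intro x y h e1 e3
    by_contra hx
    set a := fstOct x ⬝ᵥ fstOct x
    set b := fstOct x ⬝ᵥ fstOct y
    have hd1 : a • fstOct y = b • fstOct x := dotProduct_self_smul_eq_of_muO e1
    have hd2 : a • sndOct y = b • sndOct x := by
      rw [← sub_eq_zero]
      refine octMul_eq_zero (x := fstOct x) ?_ hx
      rw [octMul_sub_right, octMul_smul_right, octMul_smul_right, e3, ← octMul_smul_left,
        ← octMul_smul_left, hd1, sub_self]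
    have hxy : a • y = b • x := eq_of_fstOct_sndOct hd7
      (by rw [fstOct_smul, fstOct_smul, hd1]) (by rw [sndOct_smul, sndOct_smul, hd2])
    have := (LinearIndependent.pair_iff.1 h b (-a) (by rw [← hxy]; simp)).2
    exact hx (dotProduct_self_eq_zero.1 (neg_eq_zero.1 this))
  have hx1 := key x y h e1 e3
  have hy1 := key y x (LinearIndependent.pair_symm_iff.1 h) (by rw [muO_swap, e1, neg_zero]) e3.symm
  have hd2 := dotProduct_self_smul_eq_of_muO e2
  set a := sndOct x ⬝ᵥ sndOct x
  set b := sndOct x ⬝ᵥ sndOct y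
  have hxy : a • y = b • x := eq_of_fstOct_sndOct hd7
    (by rw [fstOct_smul, fstOct_smul, hx1, hy1, smul_zero, smul_zero])
    (by rw [sndOct_smul, sndOct_smul, hd2])
  have ha := (LinearIndependent.pair_iff.1 h b (-a) (by rw [← hxy]; simp)).2
  have hx2 : sndOct x = 0 := dotProduct_self_eq_zero.1 (neg_eq_zero.1 ha)
  have hx0 : x = 0 := by
    refine eq_of_fstOct_sndOct hd7 (hx1.trans rfl) (hx2.trans ?_)
    ext i; simp [sndOct]
  exact h.ne_zero 0 hx0

end Pair

/-- An alternating bilinear map that does not vanish on linearly independent pairs defines a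
`π₁`-isomorphism, and the linear inclusions into its domain induce `π₁`-isomorphisms. -/
theorem exists_isPi1Iso_and_incl {n k : ℕ} (hn : 3 ≤ n) (hk : 2 ≤ k)
    {μ : (Fin n → ℝ) → (Fin n → ℝ) → (Fin (k + 1) → ℝ)} (hμ : HasDetProperty μ)
    (hc : Continuous fun p : (Fin n → ℝ) × (Fin n → ℝ) => μ p.1 p.2)
    (hne : ∀ x y, LinearIndependent ℝ ![x, y] → μ x y ≠ 0) :
    (∃ f : C(Gr 2 n, RP k), IsGivenBy f μ ∧ IsPi1Iso f) ∧
      ∀ f : C(Gr 2 n, RP k), IsPi1Iso f →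
        ∀ (m : ℕ), 2 < m → ∀ (L : (Fin m → ℝ) →ₗ[ℝ] (Fin n → ℝ)) (hL : Function.Injective L),
          IsPi1Iso (f.comp (Gr.incl L hL)) := by
  obtain ⟨f, hf⟩ := exists_isGivenBy hμ hc hne
  exact ⟨⟨f, hf, hf.isPi1Iso hn hk hμ hc⟩, fun g hg m hm L hL =>
    hg.comp (hf.isPi1Iso_incl hk hμ hc hm L hL)⟩

end Formulas

theorem theorem1p2 :
    (∃ ν₄ : C(Gr 2 4, RP 2), IsGivenBy ν₄ muH ∧ IsPi1Iso ν₄) ∧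
    (∃ ν₈ : C(Gr 2 8, RP 6), IsGivenBy ν₈ muO ∧ IsPi1Iso ν₈) ∧
    (∃ ν₉ : C(Gr 2 9, RP 14), IsGivenBy ν₉ (muPair 0 (by norm_num)) ∧ IsPi1Iso ν₉) ∧
    (∃ ν₁₀ : C(Gr 2 10, RP 15), IsGivenBy ν₁₀ (muPair 1 (by norm_num)) ∧ IsPi1Iso ν₁₀) ∧
    (∃ ν₁₂ : C(Gr 2 12, RP 17), IsGivenBy ν₁₂ (muPair 3 (by norm_num)) ∧ IsPi1Iso ν₁₂) ∧
    (∃ ν₁₆ : C(Gr 2 16, RP 21), IsGivenBy ν₁₆ (muPair 7 (by norm_num)) ∧ IsPi1Iso ν₁₆) ∧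
    (∀ n k : ℕ,
      (n, k) ∈ ({(4, 2), (8, 6), (9, 14), (10, 15), (12, 17), (16, 21)} : Set (ℕ × ℕ)) →
      ∀ f : C(Gr 2 n, RP k), IsPi1Iso f →
      ∀ (m : ℕ), 2 < m → ∀ (L : (Fin m → ℝ) →ₗ[ℝ] (Fin n → ℝ)) (hL : Function.Injective L),
        IsPi1Iso (f.comp (Gr.incl L hL))) := by
  have h4 := exists_isPi1Iso_and_incl (n := 4) (k := 2) (by norm_num) le_rfl
    muH_hasDetProperty continuous_muH muH_ne_zero
  have h8 := exists_isPi1Iso_and_incl (n := 8) (k := 6) (by norm_num) (by norm_num)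
    muO_hasDetProperty (continuous_fst.muO continuous_snd) muO_ne_zero
  -- With `k = 7 + d + 7`, `k + 1` is definitionally the dimension `7 + d + 8` of the target of
  -- `muPair`.
  have hpair : ∀ (d : ℕ) (hd7 : d ≤ 7) (hd : d = 0 ∨ d = 1 ∨ d = 3 ∨ d = 7), _ :=
    fun d hd7 hd => exists_isPi1Iso_and_incl (n := 8 + (d + 1)) (k := 7 + d + 7) (by omega)
      (by omega) (muPair_hasDetProperty hd7) (continuous_muPair hd7) (muPair_ne_zero hd7 hd)
  have h9 := hpair 0 (by norm_num) (by norm_num)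
  have h10 := hpair 1 (by norm_num) (by norm_num)
  have h12 := hpair 3 (by norm_num) (by norm_num)
  have h16 := hpair 7 (by norm_num) (by norm_num)
  refine ⟨h4.1, h8.1, h9.1, h10.1, h12.1, h16.1, ?_⟩
  intro n k hnk
  simp only [Set.mem_insert_iff, Set.mem_singleton_iff, Prod.mk.injEq] at hnk
  rcases hnk with ⟨rfl, rfl⟩ | ⟨rfl, rfl⟩ | ⟨rfl, rfl⟩ | ⟨rfl, rfl⟩ | ⟨rfl, rfl⟩ | ⟨rfl, rfl⟩
  exacts [h4.2, h8.2, h9.2, h10.2, h12.2, h16.2]
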